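/- Let $\mathbb{K}$ be a field; all vector spaces are finite-dimensional over $\mathbb{K}$. For a linear subspace $\mathcal{S}$ of $\mathcal{L}(U,V)$, let $\operatorname{urk}\mathcal{S}$ (the upper-rank) be the maximal rank of an operator in $\mathcal{S}$, and let $\operatorname{trk}\mathcal{S}=\max_{x\in U}\dim\{f(x) : f\in\mathcal{S}\}$ (the transitive rank). The space $\mathcal{S}$ is called $c$-defective if $\dim\ker f\ge c$ for all $f\in\mathcal{S}$, and reduced if $\bigcap_{f\in\mathcal{S}}\ker f=\{0\}$ and $\sum_{f\in\mathcal{S}}\operatorname{im} f=V$. It is called semi-primitive if it is reduced and, with $c$ the greatest integer for which $\mathcal{S}$ is $c$-defective, there is no linear hyperplane $U'$ of $U$ for which $\{f|_{U'} : f\in\mathcal{S}\}\subset\mathcal{L}(U',V)$ is $c$-defective. These notions are applied to linear subspaces of $\mathrm{M}_{m,n}(\mathbb{K})$ by identifying $\mathrm{M}_{m,n}(\mathbb{K})$ with $\mathcal{L}(\mathbb{K}^n,\mathbb{K}^m)$. For an integer $c\ge 1$, $\mathcal{S}$ is called $c$-LLD if $\dim\{f\in\mathcal{S} : f(x)=0\}\ge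 c$ for every $x\in U$, and minimal $c$-LLD if it is minimal with respect to inclusion among the $c$-LLD subspaces of $\mathcal{L}(U,V)$. (1) Let $\mathcal{S}$ be a semi-primitive linear subspace of $\mathrm{M}_{m,n}(\mathbb{K})$, set $r:=\operatorname{urk}\mathcal{S}$, and assume that $\#\mathbb{K}>r\ge 2$. Then $\operatorname{trk}\mathcal{S}\le 6+\binom{r-2}{2}$. (2) Let $c\ge 1$ and let $\mathcal{S}\subset\mathcal{L}(U,V)$ be a minimal $c$-LLD operator space of dimension $n$, with $\#\mathbb{K}>n-c\ge 2$. Then $\operatorname{urk}\mathcal{S}\le 6+\binom{n-c-2}{2}$. -/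

import Mathlib

namespace OpSpace

section

variable {K U V : Type*} [Field K] [AddCommGroup U] [Module K U] [AddCommGroup V] [Module K V]

/-- The upper-rank of an operator space `S ⊆ L(U,V)`: the maximal rank of an operator in `S`
(see `isGreatest_upperRank`). -/
noncomputable def upperRank (S : Submodule K (U →ₗ[K] V)) : ℕ :=
  sSup {k : ℕ | ∃ f ∈ S, Module.finrank K (LinearMap.range f) = k}

/-- The subspace `S x = {f x | f ∈ S}` of `V`. -/
def orbit (S : Submodule K (U →ₗ[K] V)) (x : U) : Submodule K V :=
  S.map (LinearMap.applyₗ x)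

/-- The transitive rank of `S`: the maximal dimension of `S x` for `x ∈ U`
(see `isGreatest_transitiveRank`). -/
noncomputable def transitiveRank (S : Submodule K (U →ₗ[K] V)) : ℕ :=
  sSup {k : ℕ | ∃ x : U, Module.finrank K (orbit S x) = k}

/-- The maximum in the definition of the upper-rank is attained. -/
theorem isGreatest_upperRank [FiniteDimensional K V] (S : Submodule K (U →ₗ[K] V)) :
    IsGreatest {k : ℕ | ∃ f ∈ S, Module.finrank K (LinearMap.range f) = k} (upperRank S) := by
  have hb : BddAbove {k : ℕ | ∃ f ∈ S, Module.finrank K (LinearMap.range f) = k} := by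
    refine ⟨Module.finrank K V, ?_⟩
    rintro k ⟨f, -, rfl⟩
    exact Submodule.finrank_le _
  exact ⟨Nat.sSup_mem ⟨_, 0, S.zero_mem, rfl⟩ hb, fun k hk => le_csSup hb hk⟩

/-- The maximum in the definition of the transitive rank is attained. -/
theorem isGreatest_transitiveRank [FiniteDimensional K V] (S : Submodule K (U →ₗ[K] V)) :
    IsGreatest {k : ℕ | ∃ x : U, Module.finrank K (orbit S x) = k} (transitiveRank S) := by
  have hb : BddAbove {k : ℕ | ∃ x : U, Module.finrank K (orbit S x) = k} := by
    refine ⟨Module.finrank K V, ?_⟩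
    rintro k ⟨x, rfl⟩
    exact Submodule.finrank_le _
  exact ⟨Nat.sSup_mem ⟨_, 0, rfl⟩ hb, fun k hk => le_csSup hb hk⟩

/-- `S` is `c`-defective: the kernel of every operator in `S` has dimension at least `c`. -/
def IsDefective (c : ℕ) (S : Submodule K (U →ₗ[K] V)) : Prop :=
  ∀ f ∈ S, c ≤ Module.finrank K (LinearMap.ker f)

/-- `S` is reduced: the operators in `S` have no common zero except `0`, and the sum of their
ranges is `V`. -/
def IsReduced (S : Submodule K (U →ₗ[K] V)) : Prop :=
  (⨅ f ∈ S, LinearMap.ker f) = ⊥ ∧ (⨆ f ∈ S, LinearMap.range f) = ⊤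

/-- The space `{f|_{U'} | f ∈ S}` of restrictions to a subspace `U'` of `U`. -/
def restrict (S : Submodule K (U →ₗ[K] V)) (U' : Submodule K U) : Submodule K (U' →ₗ[K] V) :=
  S.map (LinearMap.domRestrict' U')

/-- `S` is semi-primitive: it is reduced and, where `c` is its defectiveness index (the integer
for which `S` is `c`-defective but not `(c+1)`-defective), there is no linear hyperplane `U'` of `U`
for which the space of restrictions of `S` to `U'` is `c`-defective. -/
def IsSemiPrimitive (S : Submodule K (U →ₗ[K] V)) : Prop :=
  IsReduced S ∧ ∃ c : ℕ, IsDefective c S ∧ ¬ IsDefective (c + 1) S ∧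
    ¬ ∃ U' : Submodule K U, Module.finrank K U' + 1 = Module.finrank K U ∧
      IsDefective c (restrict S U')

/-- `S` is `c`-LLD (`c`-locally linearly dependent): for every `x ∈ U`, the subspace
`{f ∈ S | f x = 0}` has dimension at least `c`. -/
def IsLLD (c : ℕ) (S : Submodule K (U →ₗ[K] V)) : Prop :=
  ∀ x : U, c ≤ Module.finrank K
    (S ⊓ LinearMap.ker (LinearMap.applyₗ x) : Submodule K (U →ₗ[K] V))

/-- `S` is a minimal `c`-LLD operator space: minimal, with respect to inclusion, among the `c`-LLD
subspaces of `L(U,V)`. -/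
def IsMinimalLLD (c : ℕ) (S : Submodule K (U →ₗ[K] V)) : Prop :=
  Minimal (fun T : Submodule K (U →ₗ[K] V) => IsLLD c T) S

end

/-- A space of `m × n` matrices seen as a space of operators from `K^n` to `K^m`. -/
def ofMatrices {K : Type*} [Field K] {m n : ℕ} (S : Submodule K (Matrix (Fin m) (Fin n) K)) :
    Submodule K ((Fin n → K) →ₗ[K] (Fin m → K)) :=
  S.map (Matrix.toLin' : Matrix (Fin m) (Fin n) K ≃ₗ[K] _).toLinearMap

end OpSpace

/-! Both statements reduce to one about operator spaces `S` of rank at most `r` in which the kernels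
of the rank `r` operators span the source (`KernelSpanned`). A semi-primitive space has this
property with `r` its upper-rank. For a minimal `c`-LLD space of dimension `n`, the dual space of
evaluations has it with `r = n - c`, and the orbits of the dual are the ranges of the original
operators. The goal is thus a bound on every orbit dimension. Since `#K > r`, the hypothesis
survives extension of scalars to the algebraic closure (the minors of size `r + 1` vanish as
polynomials), so `K` may be taken infinite. Generic choices and limits along lines are then
available.

Let `f` have rank `r` and `f z = 0`. Letting `t` tend to `0` in `f + t g` gives `S z ⊆ im f`, and `g
w ∈ im f` whenever `f w = g z`. Choose `(f, z)` with `s = dim S z` maximal (`Extremal`). Deforming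
`z` inside the union of the kernels cannot increase the orbit dimension, which yields the key fact
`Extremal.stable`: an operator of `S` killing `z` maps `A = f⁻¹(S z)` into `S z`. Hence, modulo `im
f`, the rule `(g z, f w) ↦ g w` for `w ∈ A` is a well-defined alternating map on `S z`, contributing
at most `s.choose 2` dimensions. The remainder is absorbed by adjoining orbits of kernel vectors one
at a time (`KernelSpanned.finrank_sup_image_le`). The total is at most `(s+1).choose 2 +
(r-s+1).choose 2`.

By convexity this suffices when `3 ≤ s ≤ r - 3`. For `s ≤ 2` the absorption argument alone gives a
linear bound. For `r - s = 0, 1, 2` the subspace `A` has codimension `r - s`, so the operators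
killing `z` are controlled by their values at that many further kernel vectors. This gives bounds
linear in `s`. -/

namespace OpSpace

open Module

/-! ### Ranks along lines of operators, and generic conditions over an infinite field -/

section Open

variable {K A B U V E : Type*} [Field K] [AddCommGroup A] [Module K A] [AddCommGroup B] [Module K B]
  [AddCommGroup U] [Module K U] [AddCommGroup V] [Module K V] [AddCommGroup E] [Module K E]

/-- The rank of an operator. -/
noncomputable abbrev rk (f : A →ₗ[K] B) : ℕ := finrank K (LinearMap.range f)

/-- If `x + t X x = 0` with `x ≠ 0`, then `-t⁻¹` is an eigenvalue of `X`, and there are finitely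
many of these. -/
theorem finite_not_injective_one_add_smul [FiniteDimensional K A] (X : A →ₗ[K] A) :
    {t : K | ¬ Function.Injective (LinearMap.id + t • X : A →ₗ[K] A)}.Finite := by
  have hfin : {μ : K | Module.End.HasEigenvalue X μ}.Finite := Module.End.finite_hasEigenvalue X
  have hinj : Function.Injective (fun t : K => -t⁻¹) := fun a b h => by simpa using h
  refine (hfin.preimage (f := fun t : K => -t⁻¹) hinj.injOn).subset fun t ht => ?_
  rw [Set.mem_ofPred_eq, ← LinearMap.ker_eq_bot, ← Ne, Submodule.ne_bot_iff] at ht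
  obtain ⟨x, hx, hx0⟩ := ht
  have hx' : x + t • X x = 0 := by simpa using hx
  have ht0 : t ≠ 0 := by
    rintro rfl
    exact hx0 (by simpa using hx')
  refine Module.End.hasEigenvalue_of_hasEigenvector (x := x) ⟨?_, hx0⟩
  rw [Module.End.mem_eigenspace_iff]
  have h1 : t • X x = -x := eq_neg_of_add_eq_zero_right hx'
  calc X x = t⁻¹ • (t • X x) := by rw [smul_smul, inv_mul_cancel₀ ht0, one_smul]
    _ = -t⁻¹ • x := by rw [h1, smul_neg, neg_smul]

/-- Splitting data for an operator: a section of `f` over its range and a retraction onto it. -/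
theorem exists_section_retraction (f : A →ₗ[K] B) :
    ∃ (s : LinearMap.range f →ₗ[K] A) (p : B →ₗ[K] LinearMap.range f),
      (∀ y, f (s y) = y) ∧ ∀ y : LinearMap.range f, p y = y := by
  obtain ⟨s, hs⟩ := f.rangeRestrict.exists_rightInverse_of_surjective
    (LinearMap.range_rangeRestrict f)
  obtain ⟨p, hp⟩ := (LinearMap.range f).subtype.exists_leftInverse_of_injective
    (Submodule.ker_subtype _)
  exact ⟨s, p, fun y => congrArg Subtype.val (LinearMap.congr_fun hs y),
    fun y => LinearMap.congr_fun hp y⟩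

theorem rk_comp_le_right [FiniteDimensional K B] (f : A →ₗ[K] B) (i : U →ₗ[K] A) :
    rk (f ∘ₗ i) ≤ rk f :=
  Submodule.finrank_mono (LinearMap.range_comp_le_range i f)

theorem rk_comp_le_left [FiniteDimensional K A] (f : A →ₗ[K] B) (p : B →ₗ[K] V) :
    rk (p ∘ₗ f) ≤ rk f := by
  rw [rk, LinearMap.range_comp]
  exact Submodule.finrank_map_le p _

theorem rk_eq_of_injective (f : A →ₗ[K] B) (hf : Function.Injective f) : rk f = finrank K A :=
  LinearMap.finrank_range_of_inj hf

/-- Lower semicontinuity of the rank: compressing `f + t g` by a section and a retraction of `f`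
gives an endomorphism `1 + t X` of `im f`, injective for almost all `t`. -/
theorem finite_rk_add_smul_lt [FiniteDimensional K A] [FiniteDimensional K B] (f g : A →ₗ[K] B) :
    {t : K | rk (f + t • g) < rk f}.Finite := by
  obtain ⟨s, p, hs, hp⟩ := exists_section_retraction f
  refine (finite_not_injective_one_add_smul (p ∘ₗ g ∘ₗ s)).subset fun t ht hinj => ?_
  have heq : LinearMap.id + t • (p ∘ₗ g ∘ₗ s) = p ∘ₗ ((f + t • g) ∘ₗ s) := by
    ext y
    simp [hs, hp]
  rw [heq] at hinj
  have h1 := rk_eq_of_injective _ hinj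
  have h2 := rk_comp_le_left ((f + t • g) ∘ₗ s) p
  have h3 := rk_comp_le_right (f + t • g) s
  have ht' : rk (f + t • g) < rk f := ht
  have : finrank K (LinearMap.range f) = rk f := rfl
  omega

/-- A condition on operators that is stable under scaling and under almost all perturbations along
lines. -/
def IsOpenCond (P : (U →ₗ[K] V) → Prop) : Prop :=
  (∀ f g, P f → {t : K | ¬ P (f + t • g)}.Finite) ∧ ∀ (c : K) f, c ≠ 0 → P f → P (c • f)

theorem IsOpenCond.and {P Q : (U →ₗ[K] V) → Prop} (hP : IsOpenCond P) (hQ : IsOpenCond Q) :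
    IsOpenCond fun f => P f ∧ Q f := by
  refine ⟨fun f g h => ?_, fun c f hc h => ⟨hP.2 c f hc h.1, hQ.2 c f hc h.2⟩⟩
  refine ((hP.1 f g h.1).union (hQ.1 f g h.2)).subset fun t ht => ?_
  by_contra hcon
  simp only [Set.mem_union, Set.mem_ofPred_eq, not_or, not_not] at hcon
  exact ht hcon

theorem isOpenCond_true : IsOpenCond fun _ : U →ₗ[K] V => True :=
  ⟨fun _ _ _ => by simp, fun _ _ _ _ => trivial⟩

theorem isOpenCond_le_rk [FiniteDimensional K A] [FiniteDimensional K B]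
    (L : (U →ₗ[K] V) →ₗ[K] (A →ₗ[K] B)) (k : ℕ) : IsOpenCond fun f => k ≤ rk (L f) := by
  refine ⟨fun f g h => ?_, fun c f hc h => ?_⟩
  · refine (finite_rk_add_smul_lt (L f) (L g)).subset fun t ht => ?_
    have ht' : ¬ k ≤ rk (L (f + t • g)) := ht
    rw [map_add, map_smul] at ht'
    exact lt_of_lt_of_le (not_le.1 ht') h
  · change k ≤ rk (L (c • f))
    rw [map_smul, rk, LinearMap.range_smul _ _ hc]
    exact h

theorem isOpenCond_ne_zero (L : (U →ₗ[K] V) →ₗ[K] E) : IsOpenCond fun f => L f ≠ 0 := by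
  refine ⟨fun f g h => Set.Subsingleton.finite fun a ha b hb => ?_, fun c f hc h => ?_⟩
  · simp only [Set.mem_ofPred_eq, not_not, map_add, map_smul] at ha hb
    have hab : (a - b) • L g = 0 := by
      rw [sub_smul, eq_neg_of_add_eq_zero_right ha, eq_neg_of_add_eq_zero_right hb, sub_self]
    rcases smul_eq_zero.1 hab with h0 | h0
    · exact sub_eq_zero.1 h0
    · rw [h0, smul_zero, add_zero] at ha
      exact absurd ha h
  · change L (c • f) ≠ 0
    rw [map_smul]
    exact smul_ne_zero hc h

theorem exists_ne_zero_notMem [Infinite K] {s : Set K} (hs : s.Finite) : ∃ t : K, t ≠ 0 ∧ t ∉ s := by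
  obtain ⟨t, ht⟩ := (hs.insert 0).exists_notMem
  exact ⟨t, fun h => ht (Or.inl h), fun h => ht (Or.inr h)⟩

theorem IsOpenCond.exists_and [Infinite K] {P Q : (U →ₗ[K] V) → Prop} (hP : IsOpenCond P)
    (hQ : IsOpenCond Q) {S : Submodule K (U →ₗ[K] V)} (h1 : ∃ f ∈ S, P f) (h2 : ∃ f ∈ S, Q f) :
    ∃ f ∈ S, P f ∧ Q f := by
  obtain ⟨f, hf, hPf⟩ := h1
  obtain ⟨g, hg, hQg⟩ := h2
  have hfin : {t : K | ¬ Q (g + t⁻¹ • f)}.Finite :=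
    (hQ.1 g f hQg).preimage (f := fun t : K => t⁻¹) inv_injective.injOn
  obtain ⟨t, ht0, ht⟩ := exists_ne_zero_notMem ((hP.1 f g hPf).union hfin)
  simp only [Set.mem_union, Set.mem_ofPred_eq, not_or, not_not] at ht
  refine ⟨f + t • g, S.add_mem hf (S.smul_mem t hg), ht.1, ?_⟩
  -- Stability under scaling is used here: `f + t g = t (g + t⁻¹ f)`, so the line through `f` is
  -- also seen from `g`.
  have := hQ.2 t _ ht0 ht.2
  rwa [smul_add, smul_smul, mul_inv_cancel₀ ht0, one_smul, add_comm] at this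

end Open

/-! ### Limits of ranges and of linearly independent families -/

section Limit

variable {K U V : Type*} [Field K] [AddCommGroup U] [Module K U]
  [FiniteDimensional K U] [AddCommGroup V] [Module K V] [FiniteDimensional K V]

/-- If `v ∉ im f`, appending `v` as an extra column raises the rank of `f`. By semicontinuity it
keeps this larger rank for almost every `t`, although for `t ≠ 0` the enlarged range lies in that of
`f + t g`, of dimension at most `rk f`. -/
theorem mem_range_of_forall_mem_range_add_smul [Infinite K] {f g : U →ₗ[K] V}
    (h : ∀ t : K, rk (f + t • g) ≤ rk f)
    {v : V} (hv : ∀ t : K, t ≠ 0 → v ∈ LinearMap.range (f + t • g)) : v ∈ LinearMap.range f := by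
  by_contra hcon
  set F : (U × K) →ₗ[K] V := f.coprod (LinearMap.toSpanSingleton K V v) with hF
  set G : (U × K) →ₗ[K] V := g.coprod 0 with hG
  obtain ⟨t, ht0, ht⟩ := exists_ne_zero_notMem (finite_rk_add_smul_lt F G)
  have h1 : LinearMap.range (F + t • G) ≤ LinearMap.range (f + t • g) := by
    rintro _ ⟨⟨x, a⟩, rfl⟩
    obtain ⟨y, hy⟩ := hv t ht0
    refine ⟨x + a • y, ?_⟩
    rw [map_add, map_smul, hy]
    simp only [hF, hG, LinearMap.add_apply, LinearMap.smul_apply, LinearMap.coprod_apply,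
      LinearMap.toSpanSingleton_apply, LinearMap.zero_apply]
    module
  have h2 : LinearMap.range f < LinearMap.range F := by
    refine SetLike.lt_iff_le_and_exists.2 ⟨?_, v, LinearMap.mem_range.2 ⟨(0, 1), by simp [hF]⟩, hcon⟩
    rintro _ ⟨x, rfl⟩
    exact ⟨(x, 0), by simp [hF]⟩
  have h3 := Submodule.finrank_mono h1
  have h4 := Submodule.finrank_lt_finrank_of_lt h2
  have h5 := h t
  simp only [Set.mem_ofPred_eq, not_lt] at ht
  unfold rk at *
  omega

theorem apply_mem_range_of_apply_eq_zero [Infinite K] {f g : U →ₗ[K] V}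
    (h : ∀ t : K, rk (f + t • g) ≤ rk f)
    {z : U} (hz : f z = 0) : g z ∈ LinearMap.range f :=
  mem_range_of_forall_mem_range_add_smul h fun t ht =>
    ⟨t⁻¹ • z, by simp [hz, smul_smul, inv_mul_cancel₀ ht]⟩

/-- The second-order term of the expansion: `f z = 0` and `f w = g z` give `(f + t g)(z - t w) = -t²
g w`. -/
theorem apply_mem_range_of_apply_eq [Infinite K] {f g : U →ₗ[K] V}
    (h : ∀ t : K, rk (f + t • g) ≤ rk f)
    {z w : U} (hz : f z = 0) (hw : f w = g z) : g w ∈ LinearMap.range f :=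
  mem_range_of_forall_mem_range_add_smul h fun t ht => by
    refine ⟨(-(t * t)⁻¹) • (z - t • w), ?_⟩
    have h1 : (f + t • g) (z - t • w) = -(t * t) • g w := by
      simp only [LinearMap.add_apply, LinearMap.smul_apply, map_sub, map_smul, hz, hw]
      module
    rw [map_smul, h1, smul_smul, neg_mul_neg, inv_mul_cancel₀ (mul_ne_zero ht ht), one_smul]

/-- The vector `w = (1 + t X)⁻¹ u` is rational in `t`. To stay with a pencil affine in `t`, one copy
of `w` per index becomes an additional unknown: a relation `a` among the vectors at `t` produces the
kernel vector `(a, (a i • w))` of `F + t G`. At `t = 0` this pencil is injective, hence it is so for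
almost all `t`. -/
theorem finite_not_linearIndependent_curve {R ι : Type*} [AddCommGroup R] [Module K R]
    [FiniteDimensional K R] [Fintype ι] (X : R →ₗ[K] R) (u : R) (c : ι → V) (d e : ι → R →ₗ[K] V)
    (h : LinearIndependent K fun i => c i + d i u) :
    {t : K | ¬ ∀ w, w + t • X w = u →
      LinearIndependent K fun i => c i + (d i + t • e i) w}.Finite := by
  set F : ((ι → K) × (ι → R)) →ₗ[K] V × (ι → R) :=
    { toFun := fun p => (∑ i, (p.1 i • c i + d i (p.2 i)), fun i => p.2 i - p.1 i • u)
      map_add' := fun p q => by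
        ext
        · simp only [Prod.fst_add, Prod.snd_add, Pi.add_apply, map_add, ← Finset.sum_add_distrib]
          exact Finset.sum_congr rfl fun i _ => by module
        · simp only [Prod.fst_add, Prod.snd_add, Pi.add_apply]
          module
      map_smul' := fun a p => by
        ext
        · simp only [Prod.smul_fst, Prod.smul_snd, Pi.smul_apply, map_smul, RingHom.id_apply,
            Finset.smul_sum]
          exact Finset.sum_congr rfl fun i _ => by module
        · simp only [Prod.smul_fst, Prod.smul_snd, Pi.smul_apply, RingHom.id_apply]
          module } with hF
  set G : ((ι → K) × (ι → R)) →ₗ[K] V × (ι → R) :=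
    { toFun := fun p => (∑ i, e i (p.2 i), fun i => X (p.2 i))
      map_add' := fun p q => by
        ext <;> simp [Finset.sum_add_distrib]
      map_smul' := fun a p => by
        ext <;> simp [Finset.smul_sum] } with hG
  have hFinj : Function.Injective F := by
    rw [← LinearMap.ker_eq_bot, Submodule.eq_bot_iff]
    rintro ⟨a, ω⟩ hp
    obtain ⟨h1, h2⟩ := Prod.ext_iff.1 (LinearMap.mem_ker.1 hp)
    have h2' : ∀ i, ω i = a i • u := fun i => sub_eq_zero.1 (congrFun h2 i)
    have h1' : ∑ i, a i • (c i + d i u) = 0 := by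
      rw [← show ∑ i, (a i • c i + d i (ω i)) = 0 from h1]
      exact Finset.sum_congr rfl fun i _ => by rw [h2', map_smul, smul_add]
    have ha : a = 0 := funext fun i => Fintype.linearIndependent_iff.1 h a h1' i
    refine Prod.ext ha (funext fun i => ?_)
    change ω i = 0
    rw [h2', ha, Pi.zero_apply, zero_smul]
  refine (finite_rk_add_smul_lt F G).subset fun t ht => ?_
  by_contra hcon
  refine ht fun w hw => ?_
  have hinj : Function.Injective (F + t • G) := by
    rw [← LinearMap.ker_eq_bot]
    have h1 := LinearMap.finrank_range_add_finrank_ker (F + t • G)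
    have h2 := rk_eq_of_injective F hFinj
    simp only [Set.mem_ofPred_eq, not_lt] at hcon
    unfold rk at *
    exact Submodule.finrank_eq_zero.1 (by omega)
  rw [Fintype.linearIndependent_iff]
  intro a ha
  have h0 : (F + t • G) (a, fun i => a i • w) = 0 := by
    ext
    · simp only [hF, hG, LinearMap.add_apply, LinearMap.smul_apply, LinearMap.coe_mk,
        AddHom.coe_mk, Prod.fst_add, Prod.smul_fst, Prod.fst_zero]
      rw [Finset.smul_sum, ← Finset.sum_add_distrib, ← ha]
      refine Finset.sum_congr rfl fun i _ => ?_
      simp only [map_smul, LinearMap.add_apply, LinearMap.smul_apply]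
      module
    · simp only [hF, hG, LinearMap.add_apply, LinearMap.smul_apply, LinearMap.coe_mk,
        AddHom.coe_mk, Prod.snd_add, Prod.smul_snd, Prod.snd_zero, Pi.add_apply, Pi.smul_apply,
        map_smul, Pi.zero_apply]
      rw [← hw]
      module
  have := hinj (h0.trans (map_zero _).symm)
  intro i
  exact congrFun (congrArg Prod.fst this) i

end Limit

/-! ### Dimension counts modulo a subspace -/

section Quotient

variable {K U V : Type*} [Field K] [AddCommGroup U] [Module K U]
  [AddCommGroup V] [Module K V] [FiniteDimensional K V]

theorem finrank_map_mkQ_add (Q T : Submodule K V) :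
    finrank K (T.map Q.mkQ) + finrank K (T ⊓ Q : Submodule K V) = finrank K T := by
  have h := LinearMap.finrank_range_add_finrank_ker (Q.mkQ.domRestrict T)
  rw [LinearMap.range_domRestrict, LinearMap.ker_domRestrict, Submodule.ker_mkQ] at h
  rw [← h, ← Submodule.finrank_map_subtype_eq T, Submodule.map_comap_subtype]

theorem rk_mkQ_add (Q : Submodule K V) (f : U →ₗ[K] V) :
    rk (Q.mkQ ∘ₗ f) + finrank K (LinearMap.range f ⊓ Q : Submodule K V) = rk f := by
  rw [rk, LinearMap.range_comp]
  exact finrank_map_mkQ_add Q _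

theorem finrank_sup_le_of_le_range {Q T : Submodule K V} {f : U →ₗ[K] V}
    (h : T ≤ LinearMap.range f) :
    finrank K (Q ⊔ T : Submodule K V) ≤ finrank K Q + rk (Q.mkQ ∘ₗ f) := by
  have h1 := Submodule.finrank_mono (sup_le_sup_left h Q)
  have h2 := Submodule.finrank_sup_add_finrank_inf_eq Q (LinearMap.range f)
  have h3 := rk_mkQ_add Q f
  rw [inf_comm] at h2
  unfold rk at *
  omega

/-- `T` lies in `im f ⊓ G`, of dimension at most `rk f - q`, and at least `j` of these dimensions
are already in `A`. -/
theorem finrank_sup_add_le {A G T : Submodule K V} {f : U →ₗ[K] V} {j q : ℕ} (hA : A ≤ G)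
    (hT : T ≤ LinearMap.range f) (hTG : T ≤ G) (hq : q ≤ rk (G.mkQ ∘ₗ f))
    (hj : j ≤ finrank K (LinearMap.range f ⊓ A : Submodule K V)) :
    finrank K (A ⊔ T : Submodule K V) + q + j ≤ finrank K A + rk f := by
  have h1 := Submodule.finrank_mono (sup_le_sup_left (le_inf hT hTG) A)
  have h2 := Submodule.finrank_sup_add_finrank_inf_eq A (LinearMap.range f ⊓ G)
  have h3 := rk_mkQ_add G f
  have h4 : A ⊓ (LinearMap.range f ⊓ G) = LinearMap.range f ⊓ A := by
    rw [inf_left_comm, inf_eq_left.2 hA]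
  rw [h4] at h2
  omega

end Quotient

/-! ### Total image and transporters -/

section Image

variable {K U V : Type*} [Field K] [AddCommGroup U] [Module K U]
  [AddCommGroup V] [Module K V]

/-- The sum of the ranges of the operators in `S`. -/
def image (S : Submodule K (U →ₗ[K] V)) : Submodule K V := ⨆ f ∈ S, LinearMap.range f

/-- The largest subspace of `U` that is mapped into `Q` by all the operators in `S`. -/
def transporter (S : Submodule K (U →ₗ[K] V)) (Q : Submodule K V) : Submodule K U :=
  ⨅ f ∈ S, Q.comap f

variable {S : Submodule K (U →ₗ[K] V)} {Q : Submodule K V}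

theorem apply_mem_image {f : U →ₗ[K] V} (hf : f ∈ S) (x : U) : f x ∈ image S :=
  Submodule.mem_iSup_of_mem f (Submodule.mem_iSup_of_mem hf ⟨x, rfl⟩)

theorem image_le_iff : image S ≤ Q ↔ ∀ f ∈ S, ∀ x, f x ∈ Q := by
  refine ⟨fun h f hf x => h (apply_mem_image hf x), fun h => iSup₂_le fun f hf => ?_⟩
  rintro _ ⟨x, rfl⟩
  exact h f hf x

theorem mem_transporter {x : U} : x ∈ transporter S Q ↔ ∀ f ∈ S, f x ∈ Q := by
  simp [transporter]

theorem mem_orbit {x : U} {v : V} : v ∈ orbit S x ↔ ∃ f ∈ S, f x = v := Iff.rfl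

theorem apply_mem_orbit {f : U →ₗ[K] V} (hf : f ∈ S) (x : U) : f x ∈ orbit S x := ⟨f, hf, rfl⟩

theorem orbit_le_iff {x : U} : orbit S x ≤ Q ↔ ∀ f ∈ S, f x ∈ Q := by
  refine ⟨fun h f hf => h (apply_mem_orbit hf x), fun h => ?_⟩
  rintro _ ⟨f, hf, rfl⟩
  exact h f hf

theorem orbit_le_image (x : U) : orbit S x ≤ image S :=
  orbit_le_iff.2 fun _ hf => apply_mem_image hf x

theorem transporter_eq_top_iff : transporter S Q = ⊤ ↔ image S ≤ Q := by
  rw [image_le_iff, Submodule.eq_top_iff']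
  simp only [mem_transporter]
  exact ⟨fun h f hf x => h x f hf, fun h x f hf => h f hf x⟩

end Image

/-! ### Spaces spanned by kernels of operators of maximal rank -/

section Good

variable {K U V : Type*} [Field K] [AddCommGroup U] [Module K U]
  [FiniteDimensional K U] [AddCommGroup V] [Module K V] [FiniteDimensional K V]

/-- All the operators in `S` have rank at most `r`, and every hyperplane fails to contain the kernel
of some operator of rank `r` in `S`. -/
structure KernelSpanned (S : Submodule K (U →ₗ[K] V)) (r : ℕ) : Prop where
  rk_le : ∀ f ∈ S, rk f ≤ r
  exists_restrict : ∀ H : Submodule K U, IsCoatom H → ∃ f ∈ S, r ≤ rk (f ∘ₗ H.subtype)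

variable {S : Submodule K (U →ₗ[K] V)} {r : ℕ}

theorem exists_coatom {K U : Type*} [Field K] [AddCommGroup U] [Module K U] {A : Submodule K U}
    (hA : A ≠ ⊤) : ∃ H : Submodule K U, IsCoatom H ∧ A ≤ H :=
  (eq_top_or_exists_le_coatom A).resolve_left hA

omit [FiniteDimensional K U] in
theorem exists_ker_notMem {H : Submodule K U} (hH : H ≠ ⊤) {f : U →ₗ[K] V}
    (h : rk f ≤ rk (f ∘ₗ H.subtype)) : ∃ z, f z = 0 ∧ z ∉ H := by
  have hle : LinearMap.range (f ∘ₗ H.subtype) ≤ LinearMap.range f := LinearMap.range_comp_le_range _ _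
  have heq := Submodule.eq_of_le_of_finrank_le hle h
  obtain ⟨x, -, hx⟩ := SetLike.exists_of_lt (lt_top_iff_ne_top.2 hH)
  obtain ⟨y, hy⟩ : f x ∈ LinearMap.range (f ∘ₗ H.subtype) := heq ▸ ⟨x, rfl⟩
  have hy' : f y = f x := hy
  refine ⟨x - y, by rw [map_sub, hy', sub_self], fun hmem => hx ?_⟩
  simpa using H.add_mem hmem y.2

theorem KernelSpanned.exists_ker_notMem_notMem [Infinite K] (hS : KernelSpanned S r)
    {P : (U →ₗ[K] V) → Prop} (hP : IsOpenCond P) (hex : ∃ f ∈ S, P f) {A B : Submodule K U}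
    (hA : A ≠ ⊤) (hB : B ≠ ⊤) :
    ∃ f ∈ S, P f ∧ rk f = r ∧ ∃ z, f z = 0 ∧ z ∉ A ∧ z ∉ B := by
  obtain ⟨H, hH, hAH⟩ := exists_coatom hA
  obtain ⟨H', hH', hBH⟩ := exists_coatom hB
  have h1 := isOpenCond_le_rk (LinearMap.lcomp K V H.subtype) r
  have h2 := isOpenCond_le_rk (LinearMap.lcomp K V H'.subtype) r
  obtain ⟨f, hf, ⟨hPf, hf1⟩, hf2⟩ := (hP.and h1).exists_and h2
    (hP.exists_and h1 hex (hS.exists_restrict H hH)) (hS.exists_restrict H' hH')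
  have hf1' : r ≤ rk (f ∘ₗ H.subtype) := hf1
  have hf2' : r ≤ rk (f ∘ₗ H'.subtype) := hf2
  have hr := hS.rk_le f hf
  obtain ⟨z, hz, hzH⟩ := exists_ker_notMem hH.1 (hr.trans hf1')
  obtain ⟨y, hy, hyH⟩ := exists_ker_notMem hH'.1 (hr.trans hf2')
  refine ⟨f, hf, hPf, le_antisymm hr (hf1'.trans (rk_comp_le_right f _)), ?_⟩
  -- Two hyperplanes are avoided at once by `z`, by `y`, or, if each lies in the wrong one, by `z +
  -- y`.
  by_cases hzB : z ∈ H'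
  · by_cases hyA : y ∈ H
    · refine ⟨z + y, by rw [map_add, hz, hy, add_zero], fun h => hzH ?_, fun h => hyH ?_⟩
      · simpa using H.sub_mem (hAH h) hyA
      · simpa using H'.sub_mem (hBH h) hzB
    · exact ⟨y, hy, fun h => hyA (hAH h), fun h => hyH (hBH h)⟩
  · exact ⟨z, hz, fun h => hzH (hAH h), fun h => hzB (hBH h)⟩

theorem KernelSpanned.exists_ker_notMem [Infinite K] (hS : KernelSpanned S r)
    {P : (U →ₗ[K] V) → Prop} (hP : IsOpenCond P) (hex : ∃ f ∈ S, P f) {A : Submodule K U}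
    (hA : A ≠ ⊤) : ∃ f ∈ S, P f ∧ rk f = r ∧ ∃ z, f z = 0 ∧ z ∉ A := by
  obtain ⟨f, hf, h1, h2, z, hz, hzA, -⟩ := hS.exists_ker_notMem_notMem hP hex hA hA
  exact ⟨f, hf, h1, h2, z, hz, hzA⟩

omit [FiniteDimensional K U] [FiniteDimensional K V] in
theorem KernelSpanned.rk_add_smul_le (hS : KernelSpanned S r) {f g : U →ₗ[K] V} (hf : f ∈ S)
    (hr : rk f = r) (hg : g ∈ S) (t : K) : rk (f + t • g) ≤ rk f :=
  hr.symm ▸ hS.rk_le _ (S.add_mem hf (S.smul_mem t hg))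

theorem KernelSpanned.orbit_le_range [Infinite K] (hS : KernelSpanned S r) {f : U →ₗ[K] V}
    (hf : f ∈ S) (hr : rk f = r) {z : U} (hz : f z = 0) : orbit S z ≤ LinearMap.range f :=
  orbit_le_iff.2 fun _ hg => apply_mem_range_of_apply_eq_zero (hS.rk_add_smul_le hf hr hg) hz

theorem isOpenCond_le_rk_mkQ (Q : Submodule K V) (k : ℕ) :
    IsOpenCond fun f : U →ₗ[K] V => k ≤ rk (Q.mkQ ∘ₗ f) :=
  isOpenCond_le_rk (LinearMap.compRight K Q.mkQ) k

theorem isOpenCond_le_rk_subtype (A : Submodule K U) (k : ℕ) :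
    IsOpenCond fun f : U →ₗ[K] V => k ≤ rk (f ∘ₗ A.subtype) :=
  isOpenCond_le_rk (LinearMap.lcomp K V A.subtype) k

omit [FiniteDimensional K U] [FiniteDimensional K V] in
theorem isOpenCond_apply_notMem (Q : Submodule K V) (x : U) :
    IsOpenCond fun f : U →ₗ[K] V => f x ∉ Q := by
  have h := isOpenCond_ne_zero (Q.mkQ ∘ₗ (LinearMap.applyₗ x : (U →ₗ[K] V) →ₗ[K] V))
  have heq : (fun f : U →ₗ[K] V => f x ∉ Q) =
      fun f => (Q.mkQ ∘ₗ (LinearMap.applyₗ x : (U →ₗ[K] V) →ₗ[K] V)) f ≠ 0 := by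
    funext f
    simp
  rw [heq]
  exact h

/-- A generic operator attains the rank of `g` modulo `Q` and rank `k` on `A` simultaneously; its
range then meets `Q` in dimension at least `k`. -/
theorem rk_mkQ_le_of_rk_subtype [Infinite K] {Q : Submodule K V} {A : Submodule K U} {k r : ℕ}
    (hr : ∀ f ∈ S, rk f ≤ r) (hQ : ∀ f ∈ S, ∀ w ∈ A, f w ∈ Q)
    (hk : ∃ f ∈ S, k ≤ rk (f ∘ₗ A.subtype)) {g : U →ₗ[K] V} (hg : g ∈ S) :
    rk (Q.mkQ ∘ₗ g) + k ≤ r := by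
  obtain ⟨h, hh, h1, h2⟩ := (isOpenCond_le_rk_mkQ Q (rk (Q.mkQ ∘ₗ g))).exists_and
    (isOpenCond_le_rk_subtype A k) ⟨g, hg, le_rfl⟩ hk
  have h3 := rk_mkQ_add Q h
  have h4 : LinearMap.range (h ∘ₗ A.subtype) ≤ LinearMap.range h ⊓ Q := by
    rintro _ ⟨w, rfl⟩
    exact ⟨⟨w, rfl⟩, hQ h hh w w.2⟩
  have h5 := Submodule.finrank_mono h4
  have h6 := hr h hh
  unfold rk at *
  omega

/-- While `Q` does not contain the image, some rank `r` operator `f` has a kernel vector `z` with `S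
z` not inside `Q`. Since `S z ⊆ im f`, adjoining `S z` costs at most `min s (R + 1)` dimensions. It
lowers the generic rank modulo `Q`, because a generic operator sends `z` into `S z` but outside `Q`.
-/
theorem KernelSpanned.finrank_sup_image_le [Infinite K] (hS : KernelSpanned S r) {s : ℕ}
    (hs : ∀ f ∈ S, rk f = r → ∀ z, f z = 0 → finrank K (orbit S z) ≤ s) (R : ℕ) :
    ∀ Q : Submodule K V, (∀ g ∈ S, rk (Q.mkQ ∘ₗ g) ≤ R) →
      finrank K (Q ⊔ image S : Submodule K V) ≤
        finrank K Q + ∑ i ∈ Finset.range R, min s (i + 1) := by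
  induction R with
  | zero =>
    intro Q hQ
    have : image S ≤ Q := image_le_iff.2 fun f hf x => by
      have h0 : LinearMap.range (Q.mkQ ∘ₗ f) = ⊥ :=
        Submodule.finrank_eq_zero.1 (Nat.le_zero.1 (hQ f hf))
      have h1 : (Q.mkQ ∘ₗ f) x ∈ LinearMap.range (Q.mkQ ∘ₗ f) := ⟨x, rfl⟩
      rw [h0, Submodule.mem_bot] at h1
      simpa using h1
    rw [sup_eq_left.2 this]
    simp
  | succ R ih =>
    intro Q hQ
    by_cases hle : image S ≤ Q
    · rw [sup_eq_left.2 hle]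
      exact Nat.le_add_right _ _
    obtain ⟨f, hf, -, hr, z, hz, hzQ⟩ := hS.exists_ker_notMem isOpenCond_true ⟨0, S.zero_mem, trivial⟩
      (A := transporter S Q) (fun h => hle (transporter_eq_top_iff.1 h))
    rw [mem_transporter] at hzQ
    push Not at hzQ
    have hsz := hs f hf hr z hz
    have hrange := hS.orbit_le_range hf hr hz
    have h1 := finrank_sup_le_of_le_range (Q := Q) hrange
    have h2 := hQ f hf
    have h3 := Submodule.finrank_add_le_finrank_add_finrank Q (orbit S z)
    have h4 := ih (Q ⊔ orbit S z) fun g hg => by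
      obtain ⟨h, hh, ha, hb⟩ := (isOpenCond_le_rk_mkQ (Q ⊔ orbit S z)
        (rk ((Q ⊔ orbit S z).mkQ ∘ₗ g))).exists_and (isOpenCond_apply_notMem Q z) ⟨g, hg, le_rfl⟩ hzQ
      have hlt : LinearMap.range h ⊓ Q < LinearMap.range h ⊓ (Q ⊔ orbit S z) :=
        SetLike.lt_iff_le_and_exists.2 ⟨inf_le_inf_left _ le_sup_left, h z,
          Submodule.mem_inf.2 ⟨LinearMap.mem_range.2 ⟨z, rfl⟩,
            Submodule.mem_sup_right (apply_mem_orbit hh z)⟩, fun hmem => hb hmem.2⟩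
      have h5 := Submodule.finrank_lt_finrank_of_lt hlt
      have h6 := rk_mkQ_add Q h
      have h7 := rk_mkQ_add (Q ⊔ orbit S z) h
      have h8 := hQ h hh
      omega
    rw [sup_assoc, sup_of_le_right (orbit_le_image (S := S) z)] at h4
    rw [Finset.sum_range_succ]
    omega

theorem sum_range_min_le_choose (s R : ℕ) :
    ∑ i ∈ Finset.range R, min s (i + 1) ≤ (R + 1).choose 2 := by
  induction R with
  | zero => simp
  | succ R ih =>
    have h : (R + 1 + 1).choose 2 = (R + 1).choose 1 + (R + 1).choose 2 := Nat.choose_succ_succ' _ _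
    rw [Finset.sum_range_succ, h, Nat.choose_one_right]
    omega

end Good

/-! ### The alternating map on the orbit of a kernel vector -/

section Alternating

variable {K U V : Type*} [Field K] [AddCommGroup U] [Module K U]
  [AddCommGroup V] [Module K V] [FiniteDimensional K V]
  {S : Submodule K (U →ₗ[K] V)}

theorem card_sigma_Iio (s : ℕ) :
    ((Finset.univ : Finset (Fin s)).sigma fun j => Finset.Iio j).card = s.choose 2 := by
  rw [Finset.card_sigma]
  simp only [Fin.card_Iio]
  rw [Fin.sum_univ_eq_sum_range (fun i => i) s, Finset.sum_range_id, Nat.choose_two_right]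

/-- If `S` acts on the preimage under `f` of the orbit of `z` in an alternating way modulo `Q₀`, the
image of this preimage adds at most `s.choose 2` dimensions to `Q₀`, with `s` the dimension of the
orbit of `z`. -/
theorem exists_finrank_le_add_choose {f : U →ₗ[K] V} {z : U} {Q₀ : Submodule K V} {s : ℕ}
    (hs : finrank K (orbit S z) = s) (hrange : orbit S z ≤ LinearMap.range f)
    (hker : ∀ g ∈ S, ∀ k, f k = 0 → g k ∈ Q₀)
    (hstab : ∀ g ∈ S, g z = 0 → ∀ w, f w ∈ orbit S z → g w ∈ Q₀)
    (halt : ∀ g ∈ S, ∀ w, f w = g z → g w ∈ Q₀) :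
    ∃ Q : Submodule K V, Q₀ ≤ Q ∧ (∀ g ∈ S, ∀ w, f w ∈ orbit S z → g w ∈ Q) ∧
      finrank K Q ≤ finrank K Q₀ + s.choose 2 := by
  classical
  obtain ⟨b⟩ : Nonempty (Basis (Fin s) K (orbit S z)) := ⟨finBasisOfFinrankEq K _ hs⟩
  choose M hM hMz using fun i => mem_orbit.1 (b i).2
  choose w hw using fun i => LinearMap.mem_range.1 (hrange (b i).2)
  have hMz' : ∀ i, M i z = (b i : V) := hMz
  let T : Finset V := ((Finset.univ : Finset (Fin s)).sigma fun j => Finset.Iio j).image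
    fun p => M p.2 (w p.1)
  have hT : ∀ i j, i < j → M i (w j) ∈ Submodule.span K (T : Set V) := fun i j hij =>
    Submodule.subset_span (Finset.mem_coe.2 (Finset.mem_image.2
      ⟨⟨j, i⟩, Finset.mem_sigma.2 ⟨Finset.mem_univ _, Finset.mem_Iio.2 hij⟩, rfl⟩))
  set Q := Q₀ ⊔ Submodule.span K (T : Set V) with hQ
  have hQ₀ : Q₀ ≤ Q := le_sup_left
  have hMw : ∀ i j, M i (w j) ∈ Q := by
    intro i j
    rcases lt_trichotomy i j with h | h | h
    · exact Submodule.mem_sup_right (hT i j h)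
    · subst h
      exact hQ₀ (halt _ (hM i) _ (by rw [hw, hMz']))
    · have h1 := halt _ (S.add_mem (hM i) (hM j)) (w i + w j)
        (by rw [map_add, hw, hw, LinearMap.add_apply, hMz', hMz'])
      have h2 := halt _ (hM i) (w i) (by rw [hw, hMz'])
      have h3 := halt _ (hM j) (w j) (by rw [hw, hMz'])
      -- Polarization: the diagonal values lie in `Q₀`, so the values above the diagonal determine
      -- those below it modulo `Q₀`.
      have h4 : M i (w j) = (M i + M j) (w i + w j) - M i (w i) - M j (w j) - M j (w i) := by
        simp only [map_add, LinearMap.add_apply]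
        abel
      rw [h4]
      exact Q.sub_mem (hQ₀ (Q₀.sub_mem (Q₀.sub_mem h1 h2) h3)) (Submodule.mem_sup_right (hT j i h))
  refine ⟨Q, hQ₀, fun g hg x hx => ?_, ?_⟩
  · have hgz : g z ∈ orbit S z := apply_mem_orbit hg z
    set a := b.repr ⟨g z, hgz⟩ with ha
    set c := b.repr ⟨f x, hx⟩ with hc
    have ha' : g z = ∑ i, a i • (b i : V) := by
      have := congrArg (orbit S z).subtype (b.sum_repr ⟨g z, hgz⟩)
      simp only [map_sum, map_smul, Submodule.subtype_apply] at this
      exact this.symm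
    have hc' : f x = ∑ i, c i • (b i : V) := by
      have := congrArg (orbit S z).subtype (b.sum_repr ⟨f x, hx⟩)
      simp only [map_sum, map_smul, Submodule.subtype_apply] at this
      exact this.symm
    set N := ∑ i, a i • M i with hN
    set y := ∑ i, c i • w i with hy
    have hNS : N ∈ S := S.sum_mem fun i _ => S.smul_mem _ (hM i)
    have h1 : (g - N) z = 0 := by
      rw [LinearMap.sub_apply, hN, LinearMap.sum_apply, ha', sub_eq_zero]
      exact Finset.sum_congr rfl fun i _ => by rw [LinearMap.smul_apply, hMz']
    have h2 : f (x - y) = 0 := by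
      rw [map_sub, hy, map_sum, hc', sub_eq_zero]
      exact Finset.sum_congr rfl fun i _ => by rw [map_smul, hw]
    have h3 : N y ∈ Q := by
      rw [hN, hy, LinearMap.sum_apply]
      refine Q.sum_mem fun i _ => ?_
      rw [LinearMap.smul_apply, map_sum]
      refine Q.smul_mem _ (Q.sum_mem fun j _ => ?_)
      rw [map_smul]
      exact Q.smul_mem _ (hMw i j)
    have h4 := hQ₀ (hstab _ (S.sub_mem hg hNS) h1 x hx)
    have h5 := hQ₀ (hker N hNS _ h2)
    -- `g - N` kills `z` and `x - y` is in `ker f`, so only the basis values in `N y` can leave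
    -- `Q₀`.
    have h6 : g x = (g - N) x + N (x - y) + N y := by
      simp only [map_sub, LinearMap.sub_apply]
      abel
    rw [h6]
    exact Q.add_mem (Q.add_mem h4 h5) h3
  · have h1 := Submodule.finrank_add_le_finrank_add_finrank Q₀ (Submodule.span K (T : Set V))
    have h2 : finrank K (Submodule.span K (T : Set V)) ≤ T.card := finrank_span_finset_le_card T
    have h3 : T.card ≤ s.choose 2 := Finset.card_image_le.trans (card_sigma_Iio s).le
    rw [hQ]
    omega

end Alternating

/-! ### Kernel vectors with orbit of maximal dimension -/

section Extremal

variable {K U V : Type*} [Field K] [AddCommGroup U] [Module K U]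
  [FiniteDimensional K U] [AddCommGroup V] [Module K V] [FiniteDimensional K V]

/-- `f` is an operator of rank `r` in `S`, and the orbit of `z ∈ ker f` has the largest dimension
`s` among the orbits of the vectors in the kernels of such operators. -/
structure Extremal (S : Submodule K (U →ₗ[K] V)) (r s : ℕ) (f : U →ₗ[K] V) (z : U) : Prop where
  spanned : KernelSpanned S r
  mem : f ∈ S
  rk_eq : rk f = r
  apply_eq_zero : f z = 0
  finrank_orbit : finrank K (orbit S z) = s
  finrank_le : ∀ g ∈ S, rk g = r → ∀ y, g y = 0 → finrank K (orbit S y) ≤ s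

theorem KernelSpanned.exists_extremal [Infinite K] [Nontrivial U] {S : Submodule K (U →ₗ[K] V)}
    {r : ℕ} (hS : KernelSpanned S r) : ∃ s f z, Extremal S r s f z := by
  classical
  obtain ⟨f₀, hf₀, -, hr₀, z₀, hz₀, -⟩ := hS.exists_ker_notMem isOpenCond_true
    ⟨0, S.zero_mem, trivial⟩ (A := ⊥) bot_ne_top
  let p : ℕ → Prop := fun s => ∃ f ∈ S, rk f = r ∧ ∃ z, f z = 0 ∧ finrank K (orbit S z) = s
  have hp : p (finrank K (orbit S z₀)) := ⟨f₀, hf₀, hr₀, z₀, hz₀, rfl⟩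
  have hb : ∀ z : U, finrank K (orbit S z) ≤ finrank K V := fun z => Submodule.finrank_le _
  obtain ⟨f, hf, hr, z, hz, hs⟩ := Nat.findGreatest_spec (P := p) (hb z₀) hp
  exact ⟨_, f, z, hS, hf, hr, hz, hs, fun g hg hgr y hy =>
    Nat.le_findGreatest (hb y) ⟨g, hg, hgr, y, hy, rfl⟩⟩

namespace Extremal

variable {S : Submodule K (U →ₗ[K] V)} {r s : ℕ} {f : U →ₗ[K] V} {z : U}

theorem orbit_le_range [Infinite K] (h : Extremal S r s f z) : orbit S z ≤ LinearMap.range f :=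
  h.spanned.orbit_le_range h.mem h.rk_eq h.apply_eq_zero

theorem le_rank [Infinite K] (h : Extremal S r s f z) : s ≤ r := by
  rw [← h.finrank_orbit, ← h.rk_eq]
  exact Submodule.finrank_mono h.orbit_le_range

omit [FiniteDimensional K U] in
theorem exists_basis (h : Extremal S r s f z) : ∃ M : Fin s → (U →ₗ[K] V), (∀ i, M i ∈ S) ∧
    LinearIndependent K (fun i => M i z) ∧
    Submodule.span K (Set.range fun i => M i z) = orbit S z := by
  obtain ⟨b⟩ : Nonempty (Basis (Fin s) K (orbit S z)) := ⟨finBasisOfFinrankEq K _ h.finrank_orbit⟩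
  choose M hM hMz using fun i => mem_orbit.1 (b i).2
  have heq : (fun i => M i z) = fun i => (b i : V) := funext hMz
  refine ⟨M, hM, ?_, ?_⟩
  · rw [heq]
    exact b.linearIndependent.map' (orbit S z).subtype (Submodule.ker_subtype _)
  · have h1 : Set.range (fun i => (b i : V)) = (orbit S z).subtype '' Set.range b := by
      rw [← Set.range_comp]
      rfl
    rw [heq, h1, Submodule.span_image, b.span_eq, Submodule.map_top, Submodule.range_subtype]

omit [FiniteDimensional K U] in
/-- A perturbation principle: an operator of `S` killing `z` maps the derivative at `z` of a curve
in the union of the kernels into the orbit of `z`. -/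
theorem apply_mem_orbit_of_curve [Infinite K] (h : Extremal S r s f z) {R : Type*}
    [AddCommGroup R] [Module K R] [FiniteDimensional K R] (X : R →ₗ[K] R) (u : R) (σ : R →ₗ[K] U)
    {bad : Set K} (hbad : bad.Finite)
    (hcurve : ∀ t ∉ bad, ∃ w, w + t • X w = u ∧ ∃ g ∈ S, rk g = r ∧ g (z + t • σ w) = 0)
    {N : U →ₗ[K] V} (hN : N ∈ S) (hNz : N z = 0) : N (σ u) ∈ orbit S z := by
  by_contra hcon
  obtain ⟨M, hM, hli, hspan⟩ := h.exists_basis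
  let c : Option (Fin s) → V := fun i => i.elim 0 fun i => M i z
  let d : Option (Fin s) → R →ₗ[K] V := fun i => i.elim (N ∘ₗ σ) fun _ => 0
  let e : Option (Fin s) → R →ₗ[K] V := fun i => i.elim 0 fun i => M i ∘ₗ σ
  -- These `s + 1` vectors are the limits at `t = 0` of the `M i` and of `t⁻¹ • N` evaluated at `z +
  -- t σ w`. If they were independent, a nearby kernel vector would have an orbit of dimension `s +
  -- 1`.
  have hind : LinearIndependent K fun i => c i + d i u := by
    rw [linearIndependent_option]
    have h1 : (fun i => c i + d i u) ∘ some = fun i => M i z := by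
      funext i
      simp [c, d]
    rw [h1, hspan]
    exact ⟨hli, by simpa [c, d] using hcon⟩
  obtain ⟨t, ht0, ht⟩ := exists_ne_zero_notMem
    (hbad.union (finite_not_linearIndependent_curve X u c d e hind))
  simp only [Set.mem_union, Set.mem_ofPred_eq, not_or, not_not] at ht
  obtain ⟨w, hw, g, hg, hgr, hgz⟩ := hcurve t ht.1
  have hli' := ht.2 w hw
  have hmem : ∀ i, c i + (d i + t • e i) w ∈ orbit S (z + t • σ w) := by
    rintro (_ | i)
    · refine ⟨t⁻¹ • N, S.smul_mem _ hN, ?_⟩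
      simp [c, d, e, hNz, smul_smul, inv_mul_cancel₀ ht0]
    · exact ⟨M i, hM i, by simp [c, d, e]⟩
  have hli'' : LinearIndependent K
      fun i => (⟨_, hmem i⟩ : orbit S (z + t • σ w)) :=
    LinearIndependent.of_comp (orbit S (z + t • σ w)).subtype hli'
  have h1 := hli''.fintype_card_le_finrank
  have h2 := h.finrank_le g hg hgr _ hgz
  rw [Fintype.card_option, Fintype.card_fin] at h1
  omega

theorem apply_mem_orbit_of_ker [Infinite K] (h : Extremal S r s f z) {N : U →ₗ[K] V} (hN : N ∈ S)
    (hNz : N z = 0) {k : U} (hk : f k = 0) : N k ∈ orbit S z :=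
  h.apply_mem_orbit_of_curve (0 : U →ₗ[K] U) k LinearMap.id Set.finite_empty
    (fun t _ => ⟨k, by simp, f, h.mem, h.rk_eq, by simp [h.apply_eq_zero, hk]⟩) hN hNz

/-- With `M z = f w`, the vector `z` is deformed into a kernel vector `z - t σ v` of `f + t M`,
where `(1 + t p M σ) v = f w`. The derivative at `t = 0` is `-σ (f w)`, which agrees with `-w` up to
`ker f`; that part is handled by `apply_mem_orbit_of_ker`. -/
theorem stable [Infinite K] (h : Extremal S r s f z) {N : U →ₗ[K] V} (hN : N ∈ S) (hNz : N z = 0)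
    {w : U} (hw : f w ∈ orbit S z) : N w ∈ orbit S z := by
  obtain ⟨M, hM, hMz : M z = f w⟩ := hw
  obtain ⟨σ, p, hσ, hp⟩ := exists_section_retraction f
  set u : LinearMap.range f := ⟨f w, w, rfl⟩ with hu
  have hmain : N ((-σ) u) ∈ orbit S z := by
    refine h.apply_mem_orbit_of_curve (p ∘ₗ M ∘ₗ σ) u (-σ)
      (finite_not_injective_one_add_smul (p ∘ₗ M ∘ₗ σ)) (fun t ht => ?_) hN hNz
    simp only [Set.mem_ofPred_eq, not_not] at ht
    have hsurj := LinearMap.injective_iff_surjective.1 ht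
    obtain ⟨v, hv⟩ := hsurj u
    refine ⟨v, hv, f + t • M, S.add_mem h.mem (S.smul_mem t hM), ?_⟩
    set g := f + t • M with hg
    -- `g` has rank at most `rk f`, and `p` maps its range onto `im f`; hence `p` is injective
    -- there, and a vector of `im g` vanishes as soon as `p` kills it.
    set pg : LinearMap.range g →ₗ[K] LinearMap.range f := p ∘ₗ (LinearMap.range g).subtype with hpg
    have hpgs : Function.Surjective pg := by
      intro y
      obtain ⟨x, hx⟩ := hsurj y
      refine ⟨⟨g (σ x), σ x, rfl⟩, ?_⟩
      rw [← hx]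
      simp [hpg, hg, hσ, hp]
    have hle : rk g ≤ rk f := h.spanned.rk_add_smul_le h.mem h.rk_eq hM t
    have hge : rk f ≤ rk g := LinearMap.finrank_le_finrank_of_surjective hpgs
    have hinj : Function.Injective pg :=
      (LinearMap.injective_iff_surjective_of_finrank_eq_finrank (le_antisymm hle hge)).2 hpgs
    refine ⟨(le_antisymm hle hge).trans h.rk_eq, ?_⟩
    have hv' : v + t • p (M (σ v)) = u := hv
    have hgz : g (z + t • (-σ) v) = t • ((u : V) - v - t • M (σ v)) := by
      simp only [hg, LinearMap.add_apply, LinearMap.smul_apply, LinearMap.neg_apply, map_add,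
        map_smul, map_neg, h.apply_eq_zero, hMz, hσ, hu]
      module
    have h0 : pg ⟨g (z + t • (-σ) v), _, rfl⟩ = 0 := by
      have h1 : p (g (z + t • (-σ) v)) = 0 := by
        rw [hgz, map_smul, map_sub, map_sub, map_smul, hp, hp, ← hv']
        simp
      exact h1
    exact congrArg Subtype.val (hinj (h0.trans (map_zero pg).symm))
  have h1 : f (w - σ u) = 0 := by
    rw [map_sub, hσ, sub_self]
  have h2 := h.apply_mem_orbit_of_ker hN hNz h1
  have h3 : N w = N (w - σ u) - N ((-σ) u) := by
    simp
  rw [h3]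
  exact (orbit S z).sub_mem h2 hmain

/-- The alternating map is taken modulo `im f` (dimension `r`) if some operator has rank above `s`
on `A`, which leaves a rank of at most `r - s - 1` to absorb. Otherwise `f` has maximal rank on `A`,
so the limit arguments apply to the restrictions and `S z` (dimension `s`) replaces `im f`, leaving
`r - s`. Both counts give the same bound. -/
theorem finrank_image_le_choose_add_choose [Infinite K] (h : Extremal S r s f z) :
    finrank K (image S) ≤ (s + 1).choose 2 + (r - s + 1).choose 2 := by
  have hsr := h.le_rank
  set A := (orbit S z).comap f with hA
  have hsucc : (s + 1).choose 2 = s + s.choose 2 := by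
    rw [Nat.choose_succ_succ' s 1, Nat.choose_one_right]
  have key : ∀ (Q₀ : Submodule K V) (k : ℕ), orbit S z ≤ Q₀ →
      (∀ g ∈ S, ∀ k, f k = 0 → g k ∈ Q₀) → (∀ g ∈ S, ∀ w, f w = g z → g w ∈ Q₀) →
      (∃ g ∈ S, k ≤ rk (g ∘ₗ A.subtype)) →
      finrank K (image S) ≤ finrank K Q₀ + s.choose 2 + (r - k + 1).choose 2 := by
    intro Q₀ k h0 hker halt hk
    obtain ⟨Q, -, hQ, hdim⟩ := exists_finrank_le_add_choose h.finrank_orbit h.orbit_le_range hker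
      (fun g hg hgz w hw => h0 (h.stable hg hgz hw)) halt
    have h1 := h.spanned.finrank_sup_image_le h.finrank_le (r - k) Q fun g hg => by
      have := rk_mkQ_le_of_rk_subtype (A := A) h.spanned.rk_le (fun g hg w hw => hQ g hg w hw) hk hg
      omega
    have h2 := Submodule.finrank_mono (le_sup_right : image S ≤ Q ⊔ image S)
    have h3 := sum_range_min_le_choose s (r - k)
    omega
  by_cases hcase : ∃ g ∈ S, s + 1 ≤ rk (g ∘ₗ A.subtype)
  · have h1 := key (LinearMap.range f) (s + 1) h.orbit_le_range
      (fun g hg k hk => apply_mem_range_of_apply_eq_zero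
        (h.spanned.rk_add_smul_le h.mem h.rk_eq hg) hk)
      (fun g hg w hw => apply_mem_range_of_apply_eq
        (h.spanned.rk_add_smul_le h.mem h.rk_eq hg) h.apply_eq_zero hw) hcase
    have h2 : finrank K (LinearMap.range f) = r := h.rk_eq
    obtain ⟨g, hg, hgA⟩ := hcase
    have h3 := h.spanned.rk_le g hg
    have h4 := rk_comp_le_right g A.subtype
    have h5 : (r - s + 1).choose 2 = (r - s) + (r - s).choose 2 := by
      rw [Nat.choose_succ_succ' (r - s) 1, Nat.choose_one_right]
    have h6 : r - (s + 1) + 1 = r - s := by omega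
    rw [h6] at h1
    omega
  · push Not at hcase
    have hfA : LinearMap.range (f ∘ₗ A.subtype) = orbit S z := by
      apply le_antisymm
      · rintro _ ⟨w, rfl⟩
        exact w.2
      · intro v hv
        obtain ⟨w, rfl⟩ := h.orbit_le_range hv
        exact ⟨⟨w, hv⟩, rfl⟩
    have hrk : rk (f ∘ₗ A.subtype) = s := by rw [rk, hfA, h.finrank_orbit]
    have hle : ∀ g ∈ S, ∀ t : K,
        rk (f ∘ₗ A.subtype + t • (g ∘ₗ A.subtype)) ≤ rk (f ∘ₗ A.subtype) := by
      intro g hg t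
      have h1 := hcase (f + t • g) (S.add_mem h.mem (S.smul_mem t hg))
      rw [LinearMap.add_comp, LinearMap.smul_comp] at h1
      rw [hrk]
      exact Nat.le_of_lt_succ h1
    have hmem : ∀ w, f w ∈ orbit S z → w ∈ A := fun w hw => hw
    have hzA : z ∈ A := hmem z (by rw [h.apply_eq_zero]; exact Submodule.zero_mem _)
    have hker : ∀ g ∈ S, ∀ k, f k = 0 → g k ∈ orbit S z := by
      intro g hg k hk
      have hkA : k ∈ A := hmem k (by rw [hk]; exact Submodule.zero_mem _)
      rw [← hfA]
      exact apply_mem_range_of_apply_eq_zero (hle g hg) (z := ⟨k, hkA⟩) hk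
    have halt : ∀ g ∈ S, ∀ w, f w = g z → g w ∈ orbit S z := by
      intro g hg w hw
      have hwA : w ∈ A := hmem w (by rw [hw]; exact apply_mem_orbit hg z)
      rw [← hfA]
      exact apply_mem_range_of_apply_eq (hle g hg) (z := ⟨z, hzA⟩) (w := ⟨w, hwA⟩)
        h.apply_eq_zero hw
    have h1 := key (orbit S z) s le_rfl hker halt ⟨f, h.mem, hrk.ge⟩
    rw [h.finrank_orbit] at h1
    omega

end Extremal

end Extremal

/-! ### Convexity of the binomial coefficient -/

section Numeric

theorem choose_two_succ (k : ℕ) : (k + 1).choose 2 = k + k.choose 2 := by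
  rw [Nat.choose_succ_succ' k 1, Nat.choose_one_right]

/-- Lines of slope 1 to 4, each touching `k.choose 2` at two consecutive integers. Slope `m` at `k +
1` amounts to slope `m - 1` at `k`, hence the joint induction. -/
theorem linear_le_choose_two (k : ℕ) :
    k ≤ k.choose 2 + 1 ∧ 2 * k ≤ k.choose 2 + 3 ∧ 3 * k ≤ k.choose 2 + 6 ∧
      4 * k ≤ k.choose 2 + 10 := by
  induction k with
  | zero => simp
  | succ k ih =>
    rw [choose_two_succ]
    omega

theorem choose_two_add_choose_two_le (a b : ℕ) :
    (4 + a).choose 2 + (4 + b).choose 2 ≤ 6 + (4 + a + b).choose 2 := by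
  induction b with
  | zero =>
    have : (4 : ℕ).choose 2 = 6 := rfl
    simp only [add_zero]
    omega
  | succ b ih =>
    have h1 := choose_two_succ (4 + b)
    have h2 := choose_two_succ (4 + a + b)
    rw [← add_assoc, ← add_assoc, h1, h2]
    omega

theorem sum_range_min_le_of_le_two {s : ℕ} (hs : s ≤ 2) (r : ℕ) :
    ∑ i ∈ Finset.range (r + 1), min s (i + 1) ≤ 2 * r + 1 := by
  induction r with
  | zero => simp
  | succ r ih =>
    rw [Finset.sum_range_succ]
    omega

end Numeric

/-! ### Comparing two orbits through evaluation maps -/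

section Eval

variable {K U V : Type*} [Field K] [AddCommGroup U] [Module K U]
  [FiniteDimensional K U] [AddCommGroup V] [Module K V] [FiniteDimensional K V]
  {S : Submodule K (U →ₗ[K] V)}

/-- Evaluation at `x` as a linear map on `S`. -/
def evalAt (S : Submodule K (U →ₗ[K] V)) (x : U) : S →ₗ[K] V :=
  LinearMap.applyₗ x ∘ₗ S.subtype

omit [FiniteDimensional K U] [FiniteDimensional K V] in
theorem range_evalAt (x : U) : LinearMap.range (evalAt S x) = orbit S x := by
  rw [evalAt, LinearMap.range_comp, Submodule.range_subtype]
  rfl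

/-- Modulo `G`, the vector `N x` depends only on `N z`. -/
theorem finrank_orbit_le_add {G : Submodule K V} {x z : U}
    (h : ∀ N ∈ S, N z = 0 → N x ∈ G) :
    finrank K (orbit S x) ≤ finrank K G + finrank K (orbit S z) := by
  have hle : LinearMap.ker (evalAt S z) ≤ LinearMap.ker (G.mkQ ∘ₗ evalAt S x) := fun N hN => by
    have := h N N.2 hN
    simpa [evalAt] using this
  have h1 := LinearMap.finrank_range_add_finrank_ker (evalAt S z)
  have h2 := LinearMap.finrank_range_add_finrank_ker (G.mkQ ∘ₗ evalAt S x)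
  have h3 := Submodule.finrank_mono hle
  have h4 := rk_mkQ_add G (evalAt S x)
  have h5 := Submodule.finrank_mono (inf_le_right : LinearMap.range (evalAt S x) ⊓ G ≤ G)
  unfold rk at h4
  rw [range_evalAt] at *
  omega

theorem finrank_orbit_lt_add {G : Submodule K V} {x z : U}
    (h : ∀ N ∈ S, N z = 0 → N x ∈ G) (hM : ∃ M ∈ S, M z ≠ 0 ∧ M x ∈ G) :
    finrank K (orbit S x) < finrank K G + finrank K (orbit S z) := by
  obtain ⟨M, hM, hMz, hMx⟩ := hM
  have hlt : LinearMap.ker (evalAt S z) < LinearMap.ker (G.mkQ ∘ₗ evalAt S x) := by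
    refine SetLike.lt_iff_le_and_exists.2 ⟨fun N hN => ?_, ⟨M, hM⟩, ?_, hMz⟩
    · have := h N N.2 hN
      simpa [evalAt] using this
    · simpa [evalAt] using hMx
  have h1 := LinearMap.finrank_range_add_finrank_ker (evalAt S z)
  have h2 := LinearMap.finrank_range_add_finrank_ker (G.mkQ ∘ₗ evalAt S x)
  have h3 := Submodule.finrank_lt_finrank_of_lt hlt
  have h4 := rk_mkQ_add G (evalAt S x)
  have h5 := Submodule.finrank_mono (inf_le_right : LinearMap.range (evalAt S x) ⊓ G ≤ G)
  unfold rk at h4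
  rw [range_evalAt] at *
  omega

omit [FiniteDimensional K U] in
/-- The largest rank of the operators in `S` modulo `Q` is attained. -/
theorem exists_max_rk_mkQ (S : Submodule K (U →ₗ[K] V)) (Q : Submodule K V) :
    ∃ q, (∀ g ∈ S, rk (Q.mkQ ∘ₗ g) ≤ q) ∧ ∃ g ∈ S, q ≤ rk (Q.mkQ ∘ₗ g) := by
  have h := isGreatest_upperRank (S.map (LinearMap.compRight K Q.mkQ))
  refine ⟨_, fun g hg => h.2 ⟨_, ⟨g, hg, rfl⟩, rfl⟩, ?_⟩
  obtain ⟨_, ⟨g, hg, rfl⟩, hr⟩ := h.1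
  exact ⟨g, hg, hr.ge⟩

end Eval

/-! ### The boundary cases `r - s = 0, 1, 2` -/

namespace Extremal

variable {K U V : Type*} [Field K] [AddCommGroup U] [Module K U]
  [FiniteDimensional K U] [AddCommGroup V] [Module K V] [FiniteDimensional K V]
  {S : Submodule K (U →ₗ[K] V)} {r s : ℕ} {f : U →ₗ[K] V} {z : U}

/-- Here `S z = im f`, so every `x` satisfies the hypothesis of `stable`. One dimension is saved by
the operator `M` with `M z = f x`, for which `M x ∈ im f` too. -/
theorem finrank_orbit_lt [Infinite K] (h : Extremal S r s f z) (hrs : r = s) (hr : 1 ≤ r) (x : U) :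
    finrank K (orbit S x) < 2 * r := by
  have heq : orbit S z = LinearMap.range f := Submodule.eq_of_le_of_finrank_le h.orbit_le_range
    (by rw [h.finrank_orbit, ← hrs]; exact h.rk_eq.le)
  by_cases hx : f x = 0
  · have h1 := Submodule.finrank_mono (h.spanned.orbit_le_range h.mem h.rk_eq hx)
    have h2 : finrank K (LinearMap.range f) = r := h.rk_eq
    omega
  · have hmem : f x ∈ orbit S z := heq ▸ LinearMap.mem_range.2 ⟨x, rfl⟩
    obtain ⟨M, hM, hMz⟩ := mem_orbit.1 hmem
    have h1 := finrank_orbit_lt_add (G := orbit S z) (x := x) (z := z)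
      (fun N hN hNz => h.stable hN hNz hmem) ⟨M, hM, by rwa [hMz], heq ▸
        apply_mem_range_of_apply_eq (h.spanned.rk_add_smul_le h.mem h.rk_eq hM) h.apply_eq_zero
          hMz.symm⟩
    rw [h.finrank_orbit] at h1
    omega

theorem finrank_comap_add [Infinite K] (h : Extremal S r s f z) :
    finrank K ((orbit S z).comap f) + r = finrank K U + s := by
  have h1 := LinearMap.finrank_range_add_finrank_ker ((orbit S z).mkQ ∘ₗ f)
  have h2 := rk_mkQ_add (orbit S z) f
  rw [inf_of_le_right h.orbit_le_range, h.finrank_orbit, h.rk_eq] at h2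
  rw [LinearMap.ker_comp, Submodule.ker_mkQ] at h1
  unfold rk at h2
  omega

omit [FiniteDimensional K U] [FiniteDimensional K V] in
theorem exists_apply_ne_zero (h : Extremal S r s f z) (hs : 1 ≤ s) :
    ∃ g ∈ S, g z ∉ (⊥ : Submodule K V) := by
  by_contra hcon
  push Not at hcon
  have h1 : orbit S z = ⊥ := le_bot_iff.1 (orbit_le_iff.2 hcon)
  have h2 := h.finrank_orbit
  rw [h1, finrank_bot] at h2
  omega

/-- `A` is a hyperplane, so `G` is spanned by `S z` and the orbit of one kernel vector `y ∉ A` under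
the operators killing `z`. That orbit lies in `im g ⊓ G`, of dimension at most `r - q`, and `g z` is
a nonzero vector of `im g` already in `S z`: hence `d ≤ s + (r - q) - 1 = 2 * s - q`. -/
theorem finrank_le_of_succ [Infinite K] (h : Extremal S r s f z) (hrs : r = s + 1) (hs : 1 ≤ s) :
    ∃ d q, (∀ x, finrank K (orbit S x) ≤ d + s) ∧ finrank K (image S) ≤ d + (q + 1).choose 2 ∧
      d + q ≤ 2 * s := by
  set S' := S ⊓ LinearMap.ker (LinearMap.applyₗ z : (U →ₗ[K] V) →ₗ[K] V) with hS'
  set A := (orbit S z).comap f with hA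
  set G := orbit S z ⊔ image S' with hG
  have hdimA := h.finrank_comap_add
  rw [← hA] at hdimA
  have hA_top : A ≠ ⊤ := by
    intro htop
    rw [htop, finrank_top] at hdimA
    omega
  obtain ⟨q, hq, hqex⟩ := exists_max_rk_mkQ S G
  have hz := h.exists_apply_ne_zero hs
  obtain ⟨g, hg, ⟨hgq, hgz⟩, hgr, y, hgy, hyA⟩ := h.spanned.exists_ker_notMem
    ((isOpenCond_le_rk_mkQ G q).and (isOpenCond_apply_notMem ⊥ z))
    ((isOpenCond_le_rk_mkQ G q).exists_and (isOpenCond_apply_notMem ⊥ z) hqex hz) hA_top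
  have hsub : orbit S' y ≤ orbit S y := Submodule.map_mono inf_le_left
  have hT : orbit S' y ≤ LinearMap.range g := hsub.trans (h.spanned.orbit_le_range hg hgr hgy)
  have hTG : orbit S' y ≤ G := (orbit_le_image y).trans le_sup_right
  have hj : 1 ≤ finrank K (LinearMap.range g ⊓ orbit S z : Submodule K V) :=
    Submodule.one_le_finrank_iff.2 ((Submodule.ne_bot_iff _).2
      ⟨g z, Submodule.mem_inf.2 ⟨LinearMap.mem_range.2 ⟨z, rfl⟩, apply_mem_orbit hg z⟩, hgz⟩)
  have h1 := finrank_sup_add_le (A := orbit S z) le_sup_left hT hTG hgq hj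
  have htop : A ⊔ K ∙ y = ⊤ := by
    have hlt : A < A ⊔ K ∙ y := SetLike.lt_iff_le_and_exists.2
      ⟨le_sup_left, y, Submodule.mem_sup_right (Submodule.mem_span_singleton_self y), hyA⟩
    have := Submodule.finrank_lt_finrank_of_lt hlt
    exact Submodule.eq_top_of_finrank_eq (le_antisymm (Submodule.finrank_le _) (by omega))
  have hGeq : G ≤ orbit S z ⊔ orbit S' y := by
    refine sup_le le_sup_left (transporter_eq_top_iff.1 (top_le_iff.1 (htop ▸ sup_le ?_ ?_)))
    · exact fun w hw => mem_transporter.2 fun N hN =>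
        Submodule.mem_sup_left (h.stable hN.1 hN.2 hw)
    · exact (Submodule.span_singleton_le_iff_mem _ _).2 (mem_transporter.2 fun N hN =>
        Submodule.mem_sup_right (apply_mem_orbit hN y))
  have h2 := Submodule.finrank_mono hGeq
  refine ⟨finrank K G, q, fun x => ?_, ?_, ?_⟩
  · rw [← h.finrank_orbit]
    exact finrank_orbit_le_add fun N hN hNz =>
      Submodule.mem_sup_right (apply_mem_image (S := S') ⟨hN, hNz⟩ x)
  · have h3 := h.spanned.finrank_sup_image_le h.finrank_le q G hq
    have h4 := Submodule.finrank_mono (le_sup_right : image S ≤ G ⊔ image S)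
    have h5 := sum_range_min_le_choose s q
    omega
  · rw [h.finrank_orbit, hgr] at h1
    omega

omit [FiniteDimensional K V] in
theorem le_rk_subtype_span_pair {g : U →ₗ[K] V} {x y : U}
    (hg : LinearIndependent K ![g x, g y]) :
    2 ≤ rk (g ∘ₗ (Submodule.span K {x, y}).subtype) := by
  have hx : x ∈ Submodule.span K {x, y} := Submodule.subset_span (by simp)
  have hy : y ∈ Submodule.span K {x, y} := Submodule.subset_span (by simp)
  have hli : LinearIndependent K
      ![(g ∘ₗ (Submodule.span K {x, y}).subtype).rangeRestrict ⟨x, hx⟩,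
        (g ∘ₗ (Submodule.span K {x, y}).subtype).rangeRestrict ⟨y, hy⟩] := by
    refine LinearIndependent.of_comp (LinearMap.range _).subtype ?_
    convert hg using 1
    funext i
    fin_cases i <;> rfl
  simpa using hli.fintype_card_le_finrank

/-- `A` has codimension 2, so two kernel vectors `y₁`, `y₂` complete it. If the generic rank `q`
modulo `G` is at least 3, each adds at most `r - q - 1 ≤ s - 2` dimensions to `S z`, so `dim G ≤ 3 *
s - 4`. If `q ≤ 2`, the image exceeds `G` by at most 3, and the loss is recovered by choosing `y₁`
with `S y₁` not inside `G`. -/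
theorem finrank_le_of_add_two [Infinite K] (h : Extremal S r s f z) (hrs : r = s + 2) (hs : 1 ≤ s) :
    finrank K (image S) ≤ 3 * s ∨ ∀ x, finrank K (orbit S x) + 4 ≤ 4 * s := by
  set S' := S ⊓ LinearMap.ker (LinearMap.applyₗ z : (U →ₗ[K] V) →ₗ[K] V) with hS'
  set A := (orbit S z).comap f with hA
  set G := orbit S z ⊔ image S' with hG
  have hdimA := h.finrank_comap_add
  rw [← hA] at hdimA
  have hA_top : A ≠ ⊤ := by
    intro htop
    rw [htop, finrank_top] at hdimA
    omega
  have hA2_top : ∀ y, A ⊔ K ∙ y ≠ ⊤ := by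
    intro y htop
    have h1 := Submodule.finrank_add_le_finrank_add_finrank A (K ∙ y)
    have h2 : finrank K (K ∙ y) ≤ 1 := (finrank_span_le_card {y}).trans (by simp)
    rw [htop, finrank_top] at h1
    omega
  have hsub : ∀ y, orbit S' y ≤ orbit S y := fun y => Submodule.map_mono inf_le_left
  have hTG : ∀ y, orbit S' y ≤ G := fun y => (orbit_le_image y).trans le_sup_right
  have hz := h.exists_apply_ne_zero hs
  have htop : ∀ y₁ y₂, y₁ ∉ A → y₂ ∉ A ⊔ K ∙ y₁ → A ⊔ K ∙ y₁ ⊔ K ∙ y₂ = ⊤ := by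
    intro y₁ y₂ hy₁ hy₂
    have hlt : A < A ⊔ K ∙ y₁ := SetLike.lt_iff_le_and_exists.2
      ⟨le_sup_left, y₁, Submodule.mem_sup_right (Submodule.mem_span_singleton_self y₁), hy₁⟩
    have hlt' : A ⊔ K ∙ y₁ < A ⊔ K ∙ y₁ ⊔ K ∙ y₂ := SetLike.lt_iff_le_and_exists.2
      ⟨le_sup_left, y₂, Submodule.mem_sup_right (Submodule.mem_span_singleton_self y₂), hy₂⟩
    have h1 := Submodule.finrank_lt_finrank_of_lt hlt
    have h2 := Submodule.finrank_lt_finrank_of_lt hlt'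
    exact Submodule.eq_top_of_finrank_eq (le_antisymm (Submodule.finrank_le _) (by omega))
  have hGle : ∀ y₁ y₂, y₁ ∉ A → y₂ ∉ A ⊔ K ∙ y₁ → ∀ B : Submodule K V, orbit S z ≤ B →
      orbit S' y₁ ≤ B → orbit S' y₂ ≤ B → G ≤ B := by
    intro y₁ y₂ hy₁ hy₂ B hB h1 h2
    refine sup_le hB (transporter_eq_top_iff.1 (top_le_iff.1
      (htop y₁ y₂ hy₁ hy₂ ▸ sup_le (sup_le ?_ ?_) ?_)))
    · exact fun w hw => mem_transporter.2 fun N hN => hB (h.stable hN.1 hN.2 hw)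
    · exact (Submodule.span_singleton_le_iff_mem _ _).2 (mem_transporter.2 fun N hN =>
        h1 (apply_mem_orbit hN y₁))
    · exact (Submodule.span_singleton_le_iff_mem _ _).2 (mem_transporter.2 fun N hN =>
        h2 (apply_mem_orbit hN y₂))
  obtain ⟨q, hq, hqex⟩ := exists_max_rk_mkQ S G
  have hopen := (isOpenCond_le_rk_mkQ G q).and (isOpenCond_apply_notMem ⊥ z)
  have hex := (isOpenCond_le_rk_mkQ G q).exists_and (isOpenCond_apply_notMem ⊥ z) hqex hz
  have hj : ∀ g ∈ S, g z ∉ (⊥ : Submodule K V) → ∀ B, orbit S z ≤ B →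
      1 ≤ finrank K (LinearMap.range g ⊓ B : Submodule K V) := fun g hg hgz B hB =>
    Submodule.one_le_finrank_iff.2 ((Submodule.ne_bot_iff _).2
      ⟨g z, Submodule.mem_inf.2 ⟨LinearMap.mem_range.2 ⟨z, rfl⟩, hB (apply_mem_orbit hg z)⟩, hgz⟩)
  by_cases hq3 : 3 ≤ q
  · right
    obtain ⟨g₁, hg₁, ⟨hq₁, hz₁⟩, hr₁, y₁, hy₁, hyA₁⟩ := h.spanned.exists_ker_notMem hopen hex hA_top
    obtain ⟨g₂, hg₂, ⟨hq₂, hz₂⟩, hr₂, y₂, hy₂, hyA₂⟩ :=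
      h.spanned.exists_ker_notMem hopen hex (hA2_top y₁)
    have h1 := finrank_sup_add_le (A := orbit S z) le_sup_left
      ((hsub y₁).trans (h.spanned.orbit_le_range hg₁ hr₁ hy₁)) (hTG y₁) hq₁ (hj g₁ hg₁ hz₁ _ le_rfl)
    have h2 := finrank_sup_add_le (A := orbit S z ⊔ orbit S' y₁) (sup_le le_sup_left (hTG y₁))
      ((hsub y₂).trans (h.spanned.orbit_le_range hg₂ hr₂ hy₂)) (hTG y₂) hq₂
      (hj g₂ hg₂ hz₂ _ le_sup_left)
    have h3 := Submodule.finrank_mono (hGle y₁ y₂ hyA₁ hyA₂ (orbit S z ⊔ orbit S' y₁ ⊔ orbit S' y₂)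
      (le_sup_left.trans le_sup_left) (le_sup_right.trans le_sup_left) le_sup_right)
    intro x
    have h4 := finrank_orbit_le_add (S := S) (G := G) (x := x) (z := z) fun N hN hNz =>
      Submodule.mem_sup_right (apply_mem_image (S := S') ⟨hN, hNz⟩ x)
    have h5 := h.finrank_orbit
    omega
  left
  by_cases hle : image S ≤ G
  · obtain ⟨g₁, hg₁, -, hr₁, y₁, hy₁, hyA₁⟩ := h.spanned.exists_ker_notMem hopen hex hA_top
    obtain ⟨g₂, hg₂, -, hr₂, y₂, hy₂, hyA₂⟩ :=
      h.spanned.exists_ker_notMem hopen hex (hA2_top y₁)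
    have h1 := Submodule.finrank_mono (hle.trans
      (hGle y₁ y₂ hyA₁ hyA₂ (orbit S z ⊔ orbit S y₁ ⊔ orbit S y₂)
      (le_sup_left.trans le_sup_left) ((hsub y₁).trans (le_sup_right.trans le_sup_left))
      ((hsub y₂).trans le_sup_right)))
    have h2 := Submodule.finrank_add_le_finrank_add_finrank (orbit S z ⊔ orbit S y₁) (orbit S y₂)
    have h3 := Submodule.finrank_add_le_finrank_add_finrank (orbit S z) (orbit S y₁)
    have h4 := h.finrank_le g₁ hg₁ hr₁ y₁ hy₁
    have h5 := h.finrank_le g₂ hg₂ hr₂ y₂ hy₂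
    have h6 := h.finrank_orbit
    omega
  obtain ⟨g₁, hg₁, ⟨-, hz₁⟩, hr₁, y₁, hy₁, hyA₁, hyB₁⟩ := h.spanned.exists_ker_notMem_notMem hopen hex
    hA_top (B := transporter S G) (fun htr => hle (transporter_eq_top_iff.1 htr))
  set G₂ := G ⊔ orbit S y₁ with hG₂
  obtain ⟨q', hq', hqex'⟩ := exists_max_rk_mkQ S G₂
  -- `f + g₁` sends `z` to `g₁ z`, a nonzero vector of `S z`, and `y₁` to `f y₁ ∉ S z`. So a generic
  -- operator has rank 2 on the span of `z` and `y₁`, and its range shares two dimensions with `S z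
  -- ⊔ S y₁`.
  have hli : LinearIndependent K ![(f + g₁) z, (f + g₁) y₁] := by
    rw [LinearMap.add_apply, LinearMap.add_apply, h.apply_eq_zero, hy₁, zero_add, add_zero,
      LinearIndependent.pair_iff' (by simpa using hz₁)]
    intro a ha
    exact hyA₁ (show f y₁ ∈ orbit S z from ha ▸ Submodule.smul_mem _ a (apply_mem_orbit hg₁ z))
  have hex₂ : ∃ g ∈ S, 2 ≤ rk (g ∘ₗ (Submodule.span K {z, y₁}).subtype) :=
    ⟨f + g₁, S.add_mem h.mem hg₁, le_rk_subtype_span_pair hli⟩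
  obtain ⟨g₂, hg₂, ⟨hq₂, hz₂⟩, hr₂, y₂, hy₂, hyA₂⟩ := h.spanned.exists_ker_notMem
    ((isOpenCond_le_rk_mkQ G₂ q').and (isOpenCond_le_rk_subtype (Submodule.span K {z, y₁}) 2))
    ((isOpenCond_le_rk_mkQ G₂ q').exists_and
      (isOpenCond_le_rk_subtype (Submodule.span K {z, y₁}) 2) hqex' hex₂) (hA2_top y₁)
  have hj₂ : 2 ≤ finrank K (LinearMap.range g₂ ⊓ (orbit S z ⊔ orbit S y₁) : Submodule K V) := by
    refine hz₂.trans (Submodule.finrank_mono ?_)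
    rw [LinearMap.range_comp, Submodule.range_subtype, Submodule.map_span_le]
    intro x hx
    rcases hx with rfl | rfl
    · exact ⟨⟨x, rfl⟩, Submodule.mem_sup_left (apply_mem_orbit hg₂ x)⟩
    · exact ⟨⟨x, rfl⟩, Submodule.mem_sup_right (apply_mem_orbit hg₂ x)⟩
  have h1 := finrank_sup_add_le (A := orbit S z ⊔ orbit S y₁)
    (sup_le (le_sup_left.trans le_sup_left) le_sup_right)
    ((hsub y₂).trans (h.spanned.orbit_le_range hg₂ hr₂ hy₂)) ((hTG y₂).trans le_sup_left) hq₂ hj₂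
  have hB : G₂ ≤ orbit S z ⊔ orbit S y₁ ⊔ orbit S' y₂ :=
    sup_le (hGle y₁ y₂ hyA₁ hyA₂ _ (le_sup_left.trans le_sup_left)
      ((hsub y₁).trans (le_sup_right.trans le_sup_left)) le_sup_right)
      (le_sup_right.trans le_sup_left)
  have h2 := Submodule.finrank_mono hB
  have h3 := Submodule.finrank_add_le_finrank_add_finrank (orbit S z) (orbit S y₁)
  have h4 := h.finrank_le g₁ hg₁ hr₁ y₁ hy₁
  have h5 := h.finrank_orbit
  have hlt : G < G₂ := by
    refine lt_of_le_of_ne le_sup_left fun heq => hyB₁ (mem_transporter.2 fun g hg => ?_)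
    rw [heq]
    exact Submodule.mem_sup_right (apply_mem_orbit hg y₁)
  have h6 := Submodule.finrank_lt_finrank_of_lt hlt
  have h7 := h.spanned.finrank_sup_image_le h.finrank_le q G hq
  have h8 := h.spanned.finrank_sup_image_le h.finrank_le q' G₂ hq'
  have h9 := Submodule.finrank_mono (le_sup_right : image S ≤ G ⊔ image S)
  have h10 := Submodule.finrank_mono (le_sup_right : image S ≤ G₂ ⊔ image S)
  have h11 : ∑ i ∈ Finset.range q, min s (i + 1) ≤ 3 :=
    (sum_range_min_le_choose s q).trans
      ((Nat.choose_le_choose 2 (show q + 1 ≤ 3 by omega)).trans (by decide))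
  -- By now `dim G₂ ≤ 3 * s - q'`. For `q' ≤ 1` the image adds at most `q'` to `G₂`; for `q' ≥ 2`,
  -- `dim G ≤ 3 * s - 3` and the image adds at most 3 to `G`.
  rcases Nat.lt_or_ge q' 2 with hq'2 | hq'2
  · have h12 : ∑ i ∈ Finset.range q', min s (i + 1) ≤ q' := by
      refine (sum_range_min_le_choose s q').trans ?_
      interval_cases q' <;> decide
    omega
  · omega

end Extremal

/-! ### The orbit bound over an infinite field -/

section Main

variable {K U V : Type*} [Field K] [Infinite K] [AddCommGroup U] [Module K U]
  [FiniteDimensional K U] [AddCommGroup V] [Module K V] [FiniteDimensional K V]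

theorem KernelSpanned.finrank_orbit_le {S : Submodule K (U →ₗ[K] V)} {r : ℕ}
    (hS : KernelSpanned S r) (hr : 2 ≤ r) (x : U) :
    finrank K (orbit S x) ≤ 6 + (r - 2).choose 2 := by
  rcases subsingleton_or_nontrivial U with hU | hU
  · have : orbit S x ≤ ⊥ := orbit_le_iff.2 fun g _ => by
      rw [Subsingleton.elim x 0, map_zero]
      exact Submodule.zero_mem _
    rw [le_bot_iff.1 this, finrank_bot]
    exact Nat.zero_le _
  obtain ⟨s, f, z, h⟩ := hS.exists_extremal
  have hsr := h.le_rank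
  have hle := Submodule.finrank_mono (orbit_le_image (S := S) x)
  obtain ⟨k, rfl⟩ := Nat.exists_eq_add_of_le' hr
  have hnum := linear_le_choose_two k
  rw [Nat.add_sub_cancel]
  rcases Nat.lt_or_ge s 3 with hs | hs
  · have h1 := hS.finrank_sup_image_le h.finrank_le (k + 2) ⊥ fun g hg =>
      (rk_comp_le_left g _).trans (hS.rk_le g hg)
    have h2 : ∑ i ∈ Finset.range (k + 2), min s (i + 1) ≤ 2 * (k + 1) + 1 :=
      sum_range_min_le_of_le_two (Nat.lt_succ_iff.1 hs) (k + 1)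
    rw [bot_sup_eq, finrank_bot] at h1
    omega
  rcases (show k + 2 = s ∨ k + 2 = s + 1 ∨ k + 2 = s + 2 ∨ s + 3 ≤ k + 2 by omega) with
    hp | hp | hp | hp
  · have := h.finrank_orbit_lt hp (by omega) x
    omega
  · obtain ⟨d, q, h1, h2, h3⟩ := h.finrank_le_of_succ hp (by omega)
    have h4 := h1 x
    rcases Nat.lt_or_ge q 3 with hq | hq
    · have h5 : (q + 1).choose 2 ≤ q + 1 := by interval_cases q <;> decide
      omega
    · omega
  · obtain rfl : k = s := by omega
    rcases h.finrank_le_of_add_two hp (by omega) with h1 | h1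
    · omega
    · have := h1 x
      omega
  · have h1 := h.finrank_image_le_choose_add_choose
    obtain ⟨a, rfl⟩ := Nat.exists_eq_add_of_le hs
    obtain ⟨b, hb⟩ := Nat.exists_eq_add_of_le hp
    have h2 := choose_two_add_choose_two_le a b
    have e1 : 3 + a + 1 = 4 + a := by omega
    have e2 : k + 2 - (3 + a) + 1 = 4 + b := by omega
    have e3 : 4 + a + b = k := by omega
    rw [e1, e2] at h1
    rw [e3] at h2
    omega

end Main

/-! ### Minors and rank under extension of scalars -/

section Minor

variable {K L ι E : Type*} [Field K] [Field L] [Algebra K L] [AddCommGroup E] [Module K E]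

theorem exists_fin_linearIndependent [Finite ι] {v : ι → E} {k : ℕ}
    (h : k ≤ finrank K (Submodule.span K (Set.range v))) :
    ∃ a : Fin k → ι, LinearIndependent K (v ∘ a) := by
  obtain ⟨κ, a, ha, hspan, hli⟩ := exists_linearIndependent' K v
  have : Finite κ := Finite.of_injective a ha
  have := Fintype.ofFinite κ
  rw [← hspan, finrank_span_eq_card hli] at h
  obtain ⟨e⟩ : Nonempty (Fin k ↪ κ) :=
    Function.Embedding.nonempty_of_card_le (by rwa [Fintype.card_fin])
  exact ⟨a ∘ e, hli.comp e e.injective⟩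

theorem exists_det_submatrix_ne_zero {m n : ℕ} (A : Matrix (Fin m) (Fin n) K) {k : ℕ}
    (h : k ≤ A.rank) :
    ∃ (a : Fin k → Fin m) (b : Fin k → Fin n), (A.submatrix a b).det ≠ 0 := by
  obtain ⟨a, ha⟩ := exists_fin_linearIndependent (v := A.row) (k := k)
    (by rwa [← Matrix.rank_eq_finrank_span_row])
  have hB : (A.submatrix a id).rank = k := by
    rw [LinearIndependent.rank_matrix (M := A.submatrix a id) ha, Fintype.card_fin]
  obtain ⟨b, hb⟩ := exists_fin_linearIndependent (v := (A.submatrix a id).col) (k := k)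
    (by rw [← Matrix.rank_eq_finrank_span_cols, hB])
  refine ⟨a, b, ?_⟩
  have hu : IsUnit (A.submatrix a b) := Matrix.linearIndependent_cols_iff_isUnit.1 hb
  exact ((Matrix.isUnit_iff_isUnit_det _).1 hu).ne_zero

theorem rank_le_rank_map {m n : ℕ} (A : Matrix (Fin m) (Fin n) K) :
    A.rank ≤ (A.map (algebraMap K L)).rank := by
  obtain ⟨a, b, hab⟩ := exists_det_submatrix_ne_zero A le_rfl
  have h1 : ((A.map (algebraMap K L)).submatrix a b).det ≠ 0 := by
    have h2 : ((A.map (algebraMap K L)).submatrix a b) =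
        (algebraMap K L).mapMatrix (A.submatrix a b) := rfl
    rw [h2, ← RingHom.map_det]
    exact (map_ne_zero _).2 hab
  have h3 := Matrix.rank_of_det_ne_zero h1
  have h4 := Matrix.rank_submatrix_le (A.map (algebraMap K L)) a b
  rw [Fintype.card_fin] at h3
  omega

theorem isHomogeneous_det {σ : Type*} {k : ℕ} (P : Matrix (Fin k) (Fin k) (MvPolynomial σ K))
    (h : ∀ i j, (P i j).IsHomogeneous 1) : P.det.IsHomogeneous k := by
  rw [Matrix.det_apply]
  refine MvPolynomial.IsHomogeneous.sum _ _ _ fun τ _ => ?_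
  have h1 := MvPolynomial.IsHomogeneous.prod Finset.univ (fun i => P (τ i) i) (fun _ => 1)
    fun i _ => h _ _
  rw [Finset.sum_const, Finset.card_univ, Fintype.card_fin, smul_eq_mul, mul_one] at h1
  rw [Units.smul_def]
  exact zsmul_mem ((MvPolynomial.mem_homogeneousSubmodule k _).2 h1) _

/-- A rank bound for a space of matrices over a field with more than `r` elements persists under
extension of scalars. -/
theorem rank_sum_smul_map_le {m n d r : ℕ} (A : Fin d → Matrix (Fin m) (Fin n) K)
    (hK : ((r + 1 : ℕ) : Cardinal) ≤ Cardinal.mk K)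
    (hA : ∀ t : Fin d → K, (∑ i, t i • A i).rank ≤ r) (c : Fin d → L) :
    (∑ i, c i • (A i).map (algebraMap K L)).rank ≤ r := by
  by_contra hcon
  obtain ⟨a, b, hab⟩ := exists_det_submatrix_ne_zero _ (not_le.1 hcon)
  set P : Matrix (Fin (r + 1)) (Fin (r + 1)) (MvPolynomial (Fin d) K) :=
    Matrix.of fun x y => ∑ i, MvPolynomial.X i * MvPolynomial.C (A i (a x) (b y)) with hP
  have hhom : P.det.IsHomogeneous (r + 1) := isHomogeneous_det P fun x y => by
    change (∑ i, MvPolynomial.X i * MvPolynomial.C (A i (a x) (b y))).IsHomogeneous 1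
    exact MvPolynomial.IsHomogeneous.sum _ _ _ fun i _ =>
      (MvPolynomial.isHomogeneous_X K i).mul (MvPolynomial.isHomogeneous_C (Fin d) _)
  -- Homogeneity matters: a form of degree `r + 1` vanishing everywhere is zero as soon as the field
  -- has `r + 1` elements, which is exactly `#K > r`.
  have hzero : P.det = 0 := hhom.eq_zero_of_forall_eval_eq_zero_of_le_card (fun t => by
    by_contra hne
    have h1 : (MvPolynomial.eval t).mapMatrix P = (∑ i, t i • A i).submatrix a b := by
      ext x y
      simp [hP, Matrix.sum_apply]
    rw [RingHom.map_det, h1] at hne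
    have h2 := Matrix.rank_of_det_ne_zero hne
    have h3 := Matrix.rank_submatrix_le (∑ i, t i • A i) a b
    have h4 := hA t
    rw [Fintype.card_fin] at h2
    omega) hK
  apply hab
  have h1 : (MvPolynomial.aeval c).toRingHom.mapMatrix P =
      (∑ i, c i • (A i).map (algebraMap K L)).submatrix a b := by
    ext x y
    simp [hP, Matrix.sum_apply]
  rw [← h1, ← RingHom.map_det, hzero, map_zero]

end Minor

/-! ### Passage to the algebraic closure -/

section BaseChange

variable {K : Type*} [Field K] {m n : ℕ}

/-- The extension of scalars of a space of matrices, as an operator space. -/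
def extendScalars (L : Type*) [Field L] [Algebra K L]
    (S : Submodule K (Matrix (Fin m) (Fin n) K)) :
    Submodule L ((Fin n → L) →ₗ[L] (Fin m → L)) :=
  Submodule.span L ((fun A : Matrix (Fin m) (Fin n) K => Matrix.toLin' (A.map (algebraMap K L))) ''
    (S : Set (Matrix (Fin m) (Fin n) K)))

variable {L : Type*} [Field L] [Algebra K L] {S : Submodule K (Matrix (Fin m) (Fin n) K)}

theorem rk_toLin' (A : Matrix (Fin m) (Fin n) K) : rk (Matrix.toLin' A) = A.rank := by
  rw [Matrix.toLin'_apply', Matrix.rank]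

theorem range_comp_subtype_of_isCoatom {U V : Type*} [AddCommGroup U] [Module K U]
    [AddCommGroup V] [Module K V] {H : Submodule K U} (hH : IsCoatom H) {f : U →ₗ[K] V} {z : U}
    (hz : f z = 0) (hzH : z ∉ H) : LinearMap.range (f ∘ₗ H.subtype) = LinearMap.range f := by
  refine le_antisymm (LinearMap.range_comp_le_range _ _) ?_
  rintro _ ⟨x, rfl⟩
  have hlt : H < H ⊔ K ∙ z := SetLike.lt_iff_le_and_exists.2
    ⟨le_sup_left, z, Submodule.mem_sup_right (Submodule.mem_span_singleton_self z), hzH⟩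
  obtain ⟨h, hh, y, hy, rfl⟩ := Submodule.mem_sup.1
    (show x ∈ H ⊔ K ∙ z by rw [hH.2 _ hlt]; exact Submodule.mem_top)
  obtain ⟨c, rfl⟩ := Submodule.mem_span_singleton.1 hy
  exact ⟨⟨h, hh⟩, by simp [hz]⟩

theorem toLin'_map_algebraMap_apply (A : Matrix (Fin m) (Fin n) K) (x : Fin n → K) :
    Matrix.toLin' (A.map (algebraMap K L)) (algebraMap K L ∘ x) =
      algebraMap K L ∘ Matrix.toLin' A x := by
  ext i
  simp [Matrix.mulVec, dotProduct]

/-- A hyperplane over `L` cannot contain all of `K^n`, so its trace on `K^n` lies in a hyperplane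
over `K`; a kernel vector over `K` avoiding the latter also avoids the former. -/
theorem KernelSpanned.extendScalars {r : ℕ} (hS : KernelSpanned (ofMatrices S) r)
    (hK : ((r + 1 : ℕ) : Cardinal) ≤ Cardinal.mk K) :
    KernelSpanned (OpSpace.extendScalars L S) r := by
  refine ⟨fun f hf => ?_, fun H hH => ?_⟩
  · obtain ⟨d, c, g, rfl⟩ := Submodule.mem_span_set'.1 hf
    choose A hA hAg using fun i => (g i).2
    have h1 : ∑ i, c i • (g i : (Fin n → L) →ₗ[L] (Fin m → L)) =
        Matrix.toLin' (∑ i, c i • (A i).map (algebraMap K L)) := by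
      rw [map_sum]
      exact Finset.sum_congr rfl fun i _ => by rw [map_smul, ← hAg i]
    rw [h1, rk_toLin']
    refine rank_sum_smul_map_le A hK (fun t => ?_) c
    rw [← rk_toLin']
    exact hS.rk_le _ ⟨_, S.sum_mem fun i _ => S.smul_mem _ (hA i), rfl⟩
  · let φ : (Fin n → K) →ₗ[K] (Fin n → L) := (Algebra.linearMap K L).compLeft (Fin n)
    have hφ : ∀ x, φ x = algebraMap K L ∘ x := fun x => rfl
    have hne : (H.restrictScalars K).comap φ ≠ ⊤ := by
      intro htop
      refine hH.1 (top_le_iff.1 ?_)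
      rw [← (Pi.basisFun L (Fin n)).span_eq, Submodule.span_le]
      rintro _ ⟨i, rfl⟩
      have h1 : Pi.single i (1 : K) ∈ (H.restrictScalars K).comap φ := htop ▸ Submodule.mem_top
      have h2 : φ (Pi.single i (1 : K)) = Pi.basisFun L (Fin n) i := by
        ext j
        rw [hφ, Pi.basisFun_apply, Function.comp_apply]
        by_cases hij : j = i
        · subst hij
          simp
        · simp [hij]
      rw [← h2]
      exact h1
    obtain ⟨H', hH', hle⟩ := exists_coatom hne
    obtain ⟨f, hf, hrf⟩ := hS.exists_restrict H' hH'
    obtain ⟨z, hz, hzH⟩ := OpSpace.exists_ker_notMem hH'.1 ((hS.rk_le f hf).trans hrf)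
    obtain ⟨A, hA, rfl⟩ := hf
    refine ⟨Matrix.toLin' (A.map (algebraMap K L)), Submodule.subset_span ⟨A, hA, rfl⟩, ?_⟩
    have hz' : Matrix.toLin' A z = 0 := hz
    have h1 : Matrix.toLin' (A.map (algebraMap K L)) (φ z) = 0 := by
      rw [hφ, toLin'_map_algebraMap_apply, hz']
      ext i
      simp
    rw [rk, range_comp_subtype_of_isCoatom hH h1 fun h => hzH (hle h)]
    change r ≤ rk (Matrix.toLin' (A.map (algebraMap K L)))
    rw [rk_toLin']
    refine le_trans ?_ (rank_le_rank_map A)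
    rw [← rk_toLin']
    exact hrf.trans (rk_comp_le_right _ _)

theorem finrank_orbit_le_extendScalars (x : Fin n → K) :
    finrank K (orbit (ofMatrices S) x) ≤
      finrank L (orbit (extendScalars L S) (algebraMap K L ∘ x)) := by
  obtain ⟨b⟩ : Nonempty (Basis (Fin (finrank K (orbit (ofMatrices S) x))) K
    (orbit (ofMatrices S) x)) := ⟨finBasis K _⟩
  have h1 : LinearIndependent K fun i => (b i : Fin m → K) :=
    b.linearIndependent.map' (orbit (ofMatrices S) x).subtype (Submodule.ker_subtype _)
  have h2 : LinearIndependent L fun i => algebraMap K L ∘ (b i : Fin m → K) :=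
    linearIndependent_algebraMap_comp_iff.2 h1
  have hmem : ∀ i, algebraMap K L ∘ (b i : Fin m → K) ∈
      orbit (extendScalars L S) (algebraMap K L ∘ x) := by
    intro i
    obtain ⟨f, ⟨A, hA, rfl⟩, hf⟩ := mem_orbit.1 (b i).2
    refine mem_orbit.2 ⟨_, Submodule.subset_span ⟨A, hA, rfl⟩, ?_⟩
    rw [← hf]
    exact toLin'_map_algebraMap_apply A x
  have h3 : LinearIndependent L fun i =>
      (⟨_, hmem i⟩ : orbit (extendScalars L S) (algebraMap K L ∘ x)) :=
    LinearIndependent.of_comp (orbit (extendScalars L S) (algebraMap K L ∘ x)).subtype h2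
  simpa using h3.fintype_card_le_finrank

theorem finrank_orbit_ofMatrices_le {r : ℕ} (hS : KernelSpanned (ofMatrices S) r)
    (hK : (r : ℕ∞) < ENat.card K) (hr : 2 ≤ r) (x : Fin n → K) :
    finrank K (orbit (ofMatrices S) x) ≤ 6 + (r - 2).choose 2 := by
  have hK' : ((r + 1 : ℕ) : Cardinal) ≤ Cardinal.mk K := by
    rw [← Cardinal.natCast_le_toENat]
    exact_mod_cast Order.add_one_le_of_lt hK
  exact (finrank_orbit_le_extendScalars (L := AlgebraicClosure K) x).trans
    ((hS.extendScalars hK').finrank_orbit_le hr _)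

theorem KernelSpanned.finrank_orbit_le_of_lt_card {U V : Type*} [AddCommGroup U] [Module K U]
    [FiniteDimensional K U] [AddCommGroup V] [Module K V] [FiniteDimensional K V]
    {S : Submodule K (U →ₗ[K] V)} {r : ℕ} (hS : KernelSpanned S r)
    (hK : (r : ℕ∞) < ENat.card K) (hr : 2 ≤ r) (x : U) :
    finrank K (orbit S x) ≤ 6 + (r - 2).choose 2 := by
  let e₁ := (finBasis K U).equivFun
  let e₂ := (finBasis K V).equivFun
  let T : Submodule K (Matrix (Fin (finrank K V)) (Fin (finrank K U)) K) :=
    S.map ((e₁.arrowCongr e₂).trans LinearMap.toMatrix').toLinearMap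
  have hT : ∀ g, g ∈ ofMatrices T ↔ ∃ f ∈ S, e₂.toLinearMap ∘ₗ f ∘ₗ e₁.symm.toLinearMap = g := by
    intro g
    constructor
    · rintro ⟨_, ⟨f, hf, rfl⟩, rfl⟩
      exact ⟨f, hf, by ext; simp⟩
    · rintro ⟨f, hf, rfl⟩
      refine ⟨_, ⟨f, hf, rfl⟩, ?_⟩
      ext
      simp
  have hTs : KernelSpanned (ofMatrices T) r := by
    refine ⟨fun g hg => ?_, fun H hH => ?_⟩
    · obtain ⟨f, hf, rfl⟩ := (hT g).1 hg
      exact (rk_comp_le_left _ _).trans ((rk_comp_le_right _ _).trans (hS.rk_le f hf))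
    · have hH' : IsCoatom (H.comap e₁.toLinearMap) :=
        (OrderIso.isCoatom_iff (Submodule.orderIsoMapComap e₁).symm H).2 hH
      obtain ⟨f, hf, hrf⟩ := hS.exists_restrict _ hH'
      refine ⟨_, (hT _).2 ⟨f, hf, rfl⟩, hrf.trans ?_⟩
      rw [LinearMap.comp_assoc, rk, rk, LinearMap.range_comp _ e₂.toLinearMap,
        LinearEquiv.finrank_map_eq]
      refine Submodule.finrank_mono ?_
      rintro _ ⟨w, rfl⟩
      exact ⟨⟨e₁ w, w.2⟩, by simp⟩
  have h1 := finrank_orbit_ofMatrices_le hTs hK hr (e₁ x)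
  have h2 : (orbit S x).map e₂.toLinearMap ≤ orbit (ofMatrices T) (e₁ x) := by
    rintro _ ⟨_, ⟨f, hf, rfl⟩, rfl⟩
    exact mem_orbit.2 ⟨_, (hT _).2 ⟨f, hf, rfl⟩, by simp⟩
  have h3 := Submodule.finrank_mono h2
  rw [LinearEquiv.finrank_map_eq] at h3
  exact h3.trans h1

end BaseChange

/-! ### Semi-primitive spaces and duals of minimal LLD spaces -/

section Statements

variable {K U V : Type*} [Field K] [AddCommGroup U] [Module K U]
  [FiniteDimensional K U] [AddCommGroup V] [Module K V] [FiniteDimensional K V]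

omit [FiniteDimensional K V] in
theorem finrank_add_one_of_isCoatom {H : Submodule K U} (hH : IsCoatom H) :
    finrank K H + 1 = finrank K U := by
  obtain ⟨z, -, hz⟩ := SetLike.exists_of_lt hH.lt_top
  have hlt : H < H ⊔ K ∙ z := SetLike.lt_iff_le_and_exists.2
    ⟨le_sup_left, z, Submodule.mem_sup_right (Submodule.mem_span_singleton_self z), hz⟩
  have h1 := Submodule.finrank_add_le_finrank_add_finrank H (K ∙ z)
  have h2 : finrank K (K ∙ z) ≤ 1 := (finrank_span_le_card {z}).trans (by simp)
  have h3 := Submodule.finrank_lt_finrank_of_lt hH.lt_top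
  rw [hH.2 _ hlt] at h1
  rw [finrank_top] at h1 h3
  omega

/-- On a hyperplane `H`, an operator with kernel of dimension at most `c - 1` has rank at least
`(dim U - 1) - (c - 1) = dim U - c`, which bounds the upper-rank from above. -/
theorem IsSemiPrimitive.kernelSpanned {S : Submodule K (U →ₗ[K] V)} (hS : IsSemiPrimitive S) :
    KernelSpanned S (upperRank S) := by
  obtain ⟨-, c, hc, hc', hres⟩ := hS
  have hmax := isGreatest_upperRank S
  refine ⟨fun f hf => hmax.2 ⟨f, hf, rfl⟩, fun H hH => ?_⟩
  have h1 := finrank_add_one_of_isCoatom hH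
  have h2 : ¬ IsDefective c (restrict S H) := fun h => hres ⟨H, h1, h⟩
  unfold IsDefective at h2
  push Not at h2
  obtain ⟨_, ⟨f, hf, rfl⟩, hlt⟩ := h2
  refine ⟨f, hf, ?_⟩
  obtain ⟨g, hg, hgr⟩ := hmax.1
  have h3 := LinearMap.finrank_range_add_finrank_ker g
  have h4 := hc g hg
  have h5 := LinearMap.finrank_range_add_finrank_ker (f ∘ₗ H.subtype)
  have h6 : finrank K (LinearMap.ker (f ∘ₗ H.subtype)) < c := hlt
  unfold rk
  omega

/-- The dual operator space of `S`: the space of the evaluations on `S` at the vectors of `U`. -/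
def dual (S : Submodule K (U →ₗ[K] V)) : Submodule K (S →ₗ[K] V) :=
  LinearMap.range S.subtype.flip

omit [FiniteDimensional K U] [FiniteDimensional K V] in
theorem orbit_dual (S : Submodule K (U →ₗ[K] V)) (f : S) :
    orbit (dual S) f = LinearMap.range (f : U →ₗ[K] V) := by
  ext v
  constructor
  · rintro ⟨_, ⟨x, rfl⟩, rfl⟩
    exact ⟨x, rfl⟩
  · rintro ⟨x, rfl⟩
    exact ⟨_, ⟨x, rfl⟩, rfl⟩

omit [FiniteDimensional K U] [FiniteDimensional K V] in
theorem finrank_ker_applyₗ_comp_subtype (S : Submodule K (U →ₗ[K] V)) (x : U) :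
    finrank K (LinearMap.ker ((LinearMap.applyₗ x : (U →ₗ[K] V) →ₗ[K] V) ∘ₗ S.subtype)) =
      finrank K (S ⊓ LinearMap.ker (LinearMap.applyₗ x) : Submodule K (U →ₗ[K] V)) := by
  rw [LinearMap.ker_comp, ← Submodule.finrank_map_subtype_eq S, Submodule.map_comap_subtype]

omit [FiniteDimensional K V] in
theorem finrank_le_rk_add {F : Type*} [AddCommGroup F] [Module K F] [FiniteDimensional K F]
    {ι : U →ₗ[K] F} (hι : Function.Injective ι) (ψ : F →ₗ[K] V) (H : Submodule K U) :
    finrank K H ≤ rk ((ψ ∘ₗ ι) ∘ₗ H.subtype) +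
      finrank K (H.map ι ⊓ LinearMap.ker ψ : Submodule K F) := by
  have h1 := LinearMap.finrank_range_add_finrank_ker ((ψ ∘ₗ ι) ∘ₗ H.subtype)
  have h2 : (LinearMap.ker ((ψ ∘ₗ ι) ∘ₗ H.subtype)).map (ι ∘ₗ H.subtype) ≤
      H.map ι ⊓ LinearMap.ker ψ :=
    Submodule.map_le_iff_le_comap.2 fun f hf => ⟨⟨f.1, f.2, rfl⟩, LinearMap.mem_ker.1 hf⟩
  have h3 := Submodule.finrank_mono h2
  have h4 := (Submodule.equivMapOfInjective (ι ∘ₗ H.subtype) (hι.comp H.injective_subtype)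
    (LinearMap.ker ((ψ ∘ₗ ι) ∘ₗ H.subtype))).finrank_eq
  unfold rk
  omega

/-- Being `c`-LLD bounds the rank of every evaluation. A hyperplane `H` of `S` is not `c`-LLD by
minimality, so some evaluation has a kernel of dimension below `c` on `H`, hence rank at least `(n -
1) - (c - 1)` there, with `n = dim S`. -/
theorem IsMinimalLLD.kernelSpanned_dual {S : Submodule K (U →ₗ[K] V)} {c : ℕ}
    (hS : IsMinimalLLD c S) : KernelSpanned (dual S) (finrank K S - c) := by
  refine ⟨?_, fun H hH => ?_⟩
  · rintro _ ⟨x, rfl⟩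
    have h1 := hS.prop x
    rw [← finrank_ker_applyₗ_comp_subtype] at h1
    have h2 := LinearMap.finrank_range_add_finrank_ker
      ((LinearMap.applyₗ x : (U →ₗ[K] V) →ₗ[K] V) ∘ₗ S.subtype)
    change rk ((LinearMap.applyₗ x : (U →ₗ[K] V) →ₗ[K] V) ∘ₗ S.subtype) ≤ _
    unfold rk
    omega
  · have hlt : H.map S.subtype < S := by
      refine lt_of_le_of_ne (Submodule.map_subtype_le S H) fun heq => hH.1 ?_
      exact Submodule.map_injective_of_injective S.injective_subtype
        (heq.trans (Submodule.map_subtype_top S).symm)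
    have h1 := hS.not_prop_of_lt hlt
    unfold IsLLD at h1
    push Not at h1
    obtain ⟨x, hx⟩ := h1
    refine ⟨evalAt S x, ⟨x, rfl⟩, ?_⟩
    have h2 := finrank_add_one_of_isCoatom hH
    have h3 := finrank_le_rk_add S.injective_subtype
      (LinearMap.applyₗ x : (U →ₗ[K] V) →ₗ[K] V) H
    have h4 : ∀ a b : ℕ, finrank K H ≤ a + b → b < c → finrank K S - c ≤ a := by
      omega
    exact h4 _ _ h3 hx

end Statements

end OpSpace

theorem mainTheorem6 {K : Type*} [Field K] :
    (∀ (m n r : ℕ) (S : Submodule K (Matrix (Fin m) (Fin n) K)),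
      OpSpace.IsSemiPrimitive (OpSpace.ofMatrices S) →
      OpSpace.upperRank (OpSpace.ofMatrices S) = r →
      (r : ℕ∞) < ENat.card K → 2 ≤ r →
      OpSpace.transitiveRank (OpSpace.ofMatrices S) ≤ 6 + (r - 2).choose 2) ∧
    (∀ (U V : Type*) [AddCommGroup U] [Module K U] [FiniteDimensional K U]
      [AddCommGroup V] [Module K V] [FiniteDimensional K V]
      (c n : ℕ) (S : Submodule K (U →ₗ[K] V)),
      1 ≤ c → OpSpace.IsMinimalLLD c S → Module.finrank K S = n →
      ((n - c : ℕ) : ℕ∞) < ENat.card K → 2 ≤ n - c →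
      OpSpace.upperRank S ≤ 6 + (n - c - 2).choose 2) := by
  refine ⟨fun m n r S hS hr hK h2 => ?_, fun U V _ _ _ _ _ _ c n S _ hS hn hK h2 => ?_⟩
  · obtain ⟨x, hx⟩ := (OpSpace.isGreatest_transitiveRank (OpSpace.ofMatrices S)).1
    rw [← hx]
    exact OpSpace.finrank_orbit_ofMatrices_le (hr ▸ hS.kernelSpanned) hK h2 x
  · obtain ⟨f, hf, hfr⟩ := (OpSpace.isGreatest_upperRank S).1
    rw [← hfr, ← OpSpace.orbit_dual S ⟨f, hf⟩]
    exact (hn ▸ hS.kernelSpanned_dual).finrank_orbit_le_of_lt_card hK h2 _
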